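/- All graphs are simple. A *complete $d$-ary tree of height $m$* is a rooted tree whose internal vertices have $d$ children and whose leaves are at distance $m$ from the root. A *$(d,r,h)$-graph* is a bipartite graph with girth at least $h$ consisting of a complete $d$-ary tree together with $r$ additional edges (*augmenting edges*) from each leaf to $r$ of its ancestors. Given an ordering of the children at each internal vertex, colour the edge from a parent to its $i$-th child with $i\in\{1,\dots,d\}$; the corresponding *reduced* $(d,r,h)$-graph is obtained by deleting, at each non-root internal vertex $v$, the subtree under the descending edge at $v$ whose colour equals that of the edge from $v$ to its parent. Fix $g\in\mathbb N$ with $g\equiv 4\pmod 6$. Rooted graphs $G_k$ ($k\ge 2$) are constructed recursively as follows. $G_2$ consists of two $g$-cycles sharing exactly one vertex, which is the root. For $k\ge3$, given a graph $G_{k-1}$, let $r=|V(G_{k-1})|-1$, and let $(A,B)$ be the bipartition of $G_{k-1}$ with the root in $A$. Take a reduced $(k,r,2g)$-graph with underlying tree $T$. For each leaf $v$ of $T$, choose a set $A(v)$ of $|A|-1$ of the $r$ augmenting edges at $v$, and replace each of the remaining $|B|$ augmenting edges $vx$ by $vx'$, where $x'$ is the vertex following $x$ on the path in $T$ from $x$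 to $v$; let $B(v)$ be the set of these new edges. Then add a copy of $G_{k-1}$ for each leaf $v$ of $T$, merging its root with $v$, and redistribute the edges of $A(v)\cup B(v)$ so that each non-root vertex of the copy that comes from $A$ inherits (as its new lower endpoint) exactly one edge of $A(v)$ and each vertex that comes from $B$ exactly one edge of $B(v)$. The result is $G_k$; its root is the root of $T$. **Theorem.** Let $g\equiv4\pmod 6$ and $k\ge2$. A graph $G_k$ as above exists. Moreover, every graph $G_k$ that arises from this construction (whatever choices are made in it) is finite and bipartite, has girth at least $g$, and each of its proper subgraphs has average degree at most $2(k-1)$; and it has an assignment $L$ of a list $L(v)$ of exactly $k$ colours to every vertex $v$ such that $|L(u)\cap L(v)|=1$ for every edge $uv$ of $G_k$, and yet $G_k$ is not $L$-colourable, i.e. it has no proper colouring $f$ with $f(v)\in L(v)$ for all vertices $v$. -/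

import Mathlib

/-- The average degree `2|E(H)| / |V(H)|` of a subgraph of a finite graph
(it is `0` for the subgraph without vertices). -/
noncomputable def avgDegree {V : Type} {G : SimpleGraph V} (H : G.Subgraph) : ℚ :=
  2 * (H.edgeSet.ncard : ℚ) / (H.verts.ncard : ℚ)

/-- `G` is `L`-colourable: it has a proper colouring that picks the colour of every vertex `v`
from the list `L v`. -/
def IsListColorable {V : Type} (G : SimpleGraph V) (L : V → Finset ℕ) : Prop :=
  ∃ f : G.Coloring ℕ, ∀ v, f v ∈ L v

/-- The graph obtained from a complete `d`-ary tree of height `m` by joining each leaf to some of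
its ancestors.

The vertices of the tree are the words of length at most `m` over the alphabet `Fin d`. Words are
written with the last letter first: the root is `[]`, the child of `w` along the descending edge
with colour `i` is `i :: w`, the leaves are the words of length `m`, and the ancestor of `w` at
distance `j` from `w` in the tree is `w.drop j`. The leaf `w` is joined to its ancestors at the
distances in `D w` (values of `D` at other words play no role). -/
def augmentedTree (d m : ℕ) (D : List (Fin d) → Finset ℕ) :
    SimpleGraph {w : List (Fin d) // w.length ≤ m} :=
  SimpleGraph.fromRel fun u w =>
    (∃ i : Fin d, u.1 = i :: w.1) ∨ (u.1.length = m ∧ ∃ j ∈ D u.1, w.1 = u.1.drop j)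

/-- `(d, r, g)`-graphs: bipartite `r`-augmented complete `d`-ary trees (here of height `m`) with
girth at least `g`. Each leaf has exactly `r` augmenting edges; as these are edges added to the
tree, they lead to ancestors other than the parent. -/
structure IsAugmentedTreeGraph (d r g m : ℕ) (D : List (Fin d) → Finset ℕ) : Prop where
  card_eq : ∀ w : List (Fin d), w.length = m → (D w).card = r
  mem_bounds : ∀ w : List (Fin d), w.length = m → ∀ j ∈ D w, 2 ≤ j ∧ j ≤ m
  bipartite : (augmentedTree d m D).IsBipartite
  girth_le : (g : ℕ∞) ≤ (augmentedTree d m D).egirth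

/-- The non-leaf vertices of the reduced tree. Reducing the complete `d`-ary tree deletes, at each
non-root internal vertex, the subtree under the descending edge having the colour of the edge to
the parent; what remains are the words in which no two consecutive letters are equal. -/
abbrev ReducedInner (d m : ℕ) : Type :=
  {w : List (Fin d) // w.length < m ∧ w.IsChain (· ≠ ·)}

/-- The leaves of the reduced tree of height `m`. -/
abbrev ReducedLeaf (d m : ℕ) : Type :=
  {w : List (Fin d) // w.length = m ∧ w.IsChain (· ≠ ·)}

/-- The distance from the leaf `v` to the tree-neighbour of the copy `x_v` of the vertex `x` of `G`
in the copy of `G` at `v`. The root `ρ` of the copy is `v` itself, whose neighbour is its parent.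
Any other `x` inherits the augmenting edge of length `β v x` at `v`, as it is when `x` is in the
same part of `G` as `ρ`, and with its upper end moved one step towards `v` when `x` is in the other
part. -/
def attachDist {V L : Type} [DecidableEq V] (ρ : V) (c : V → Bool) (β : L → V → ℕ)
    (v : L) (x : V) : ℕ :=
  if x = ρ then 1 else if c x = c ρ then β v x else β v x - 1

open Classical in
/-- The graph formed from the reduced `d`-ary tree of height `m` by adding for each leaf `v` a copy
of `G`, whose root `ρ` is merged with `v` and whose other vertices inherit the augmenting edges
at `v`. The vertex `Sum.inr (v, x)` is the copy of `x` at `v`; in particular `Sum.inr (v, ρ)` is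
the leaf `v`. -/
noncomputable def attachCopies {V : Type} (G : SimpleGraph V) (ρ : V) (d m : ℕ) (c : V → Bool)
    (β : ReducedLeaf d m → V → ℕ) :
    SimpleGraph (ReducedInner d m ⊕ ReducedLeaf d m × V) :=
  SimpleGraph.fromRel fun p q =>
    match p, q with
    | Sum.inl u, Sum.inl w => ∃ i : Fin d, u.1 = i :: w.1
    | Sum.inr (v, x), Sum.inl w => w.1 = v.1.drop (attachDist ρ c β v x)
    | Sum.inr (v, x), Sum.inr (v', y) => v = v' ∧ G.Adj x y
    | Sum.inl _, Sum.inr _ => False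

/-- Two cycles of length `g` sharing exactly one vertex, the vertex `none`. The other vertices of
the cycle with index `b` are, in order, `some (b, 0), …, some (b, g - 2)`. -/
def twoCycles (g : ℕ) : SimpleGraph (Option (Bool × Fin (g - 1))) :=
  SimpleGraph.fromRel fun p q =>
    match p, q with
    | none, some (_, i) => i.val = 0 ∨ i.val + 1 = g - 1
    | some (b, i), some (b', j) => b = b' ∧ i.val + 1 = j.val
    | _, _ => False

/-- `IsChoiceGraph g k V G ρ`: the graph `G` on `V` with root `ρ` is a possible outcome `G_k` of the
recursive construction with parameter `g`.

* `G_2` consists of two `g`-cycles sharing one vertex, which is the root.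
* Given `G_{k}` (here `G`, with root `ρ`), let `r = |V(G_{k})| - 1`, take any
  `(k + 1, r, 2g)`-graph (given by its height `m` and the distances `D`) and reduce it. The
  bipartition of `G_{k}` is given by the proper 2-colouring `c`. For each leaf `v` distribute the
  `r` augmenting edges at `v` bijectively (by `β v`) among the non-root vertices of a copy of
  `G_{k}` at `v`, the upper ends of the edges given to the part not containing the root being moved
  one step towards `v`. The root of the tree is the root of `G_{k+1}`. -/
inductive IsChoiceGraph (g : ℕ) : ℕ → (V : Type) → SimpleGraph V → V → Prop
  | base : IsChoiceGraph g 2 (Option (Bool × Fin (g - 1))) (twoCycles g) none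
  | step {k : ℕ} {V : Type} {G : SimpleGraph V} {ρ : V} (h : IsChoiceGraph g k V G ρ)
      (m : ℕ) (hm : 0 < m) (D : List (Fin (k + 1)) → Finset ℕ)
      (hD : IsAugmentedTreeGraph (k + 1) (Nat.card V - 1) (2 * g) m D)
      (c : G.Coloring Bool) (β : ReducedLeaf (k + 1) m → V → ℕ)
      (hβ : ∀ v, Set.BijOn (β v) {x | x ≠ ρ} (D v.1 : Set ℕ)) :
      IsChoiceGraph g (k + 1) (ReducedInner (k + 1) m ⊕ ReducedLeaf (k + 1) m × V)
        (attachCopies G ρ (k + 1) m c β) (Sum.inl ⟨[], hm, List.isChain_nil⟩)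

/-! Girth. All nontrivial cycle bounds follow one scheme. Delete an edge of the cycle, map the
remaining walk to a graph of known girth so that every edge becomes a short walk avoiding the image
of the deleted edge, and close up again (`Walk.joinedAvoiding_map`, `JoinedAvoiding.egirth_le`).

Existence of augmented trees (`exists_oddAugmentation`) is a double induction, on the girth and then
on the number `r` of augmenting edges. Take a tree with `r` edges per leaf, girth `g + 1` and height
`m₁`, and an `N`-ary one of girth `g` with `N = d ^ m₁` edges per leaf. Expand each star of the
latter into a `d`-ary tree of height `m₁`, hang the former below each leaf, and hand the `N`
augmenting edges of that leaf to the `N` leaves hanging there. A cycle through a new edge contracts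
to a closed walk in the `N`-ary graph and loses an edge on the way; any other cycle projects to the
first graph (`egirth_extendAug`).

Girth of `G_k`: contracting every copy to its leaf turns an edge into at most two edges of the
augmented tree, so girth `2g` there yields `g`. A cycle using no inherited augmenting edge retracts
to a single copy (`attachCopies_egirth`).

Lists: a tree vertex may choose among its incident tree edges. From the root, every choice made
along the resulting path must point downwards, so some path to a leaf `v` has each edge chosen by
its upper end. Each vertex of the copy at `v` has, besides its old list, only the path edge just
below its tree neighbour, which is blocked; so the copy would be coloured from bad lists
(`HasSeparatedBadLists.attachCopies`).

Density: the invariant is `|E(H)| ≤ (k - 1)|V(H)| + 1`, with equality only for the whole graph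
(`IsNearlySparse`). In the step, only a complete copy with all its upward edges has surplus `1`;
charge it to the parent of its leaf. The children of a set of tree vertices outnumber the bound by
at most `1`, and only if the root is present (`card_lower_le`). -/

namespace SimpleGraph

/-! ### Walks avoiding an edge -/

variable {V W : Type} {G : SimpleGraph V} {H : SimpleGraph W}

theorem Walk.exists_append_cons_of_mem_darts {x y : V} (p : G.Walk x y) {d : G.Dart}
    (hd : d ∈ p.darts) :
    ∃ (p₁ : G.Walk x d.fst) (p₂ : G.Walk d.snd y), p = p₁.append (Walk.cons d.adj p₂) := by
  induction p with
  | nil => simp at hd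
  | cons h p ih =>
    rw [Walk.darts_cons, List.mem_cons] at hd
    rcases hd with rfl | hd
    · exact ⟨Walk.nil, p, rfl⟩
    · obtain ⟨p₁, p₂, rfl⟩ := ih hd
      exact ⟨Walk.cons h p₁, p₂, rfl⟩

/-- Removing an edge from a cycle leaves a walk between the ends of that edge. -/
theorem Walk.IsCycle.exists_walk_of_mem_edges {x a b : V} {p : G.Walk x x} (hp : p.IsCycle)
    (h : s(a, b) ∈ p.edges) :
    ∃ q : G.Walk b a, q.length + 1 = p.length ∧ s(a, b) ∉ q.edges ∧ q.edges ⊆ p.edges := by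
  have key : ∀ d ∈ p.darts, ∃ q : G.Walk d.snd d.fst,
      q.length + 1 = p.length ∧ d.edge ∉ q.edges ∧ q.edges ⊆ p.edges := by
    intro d hd
    obtain ⟨p₁, p₂, rfl⟩ := p.exists_append_cons_of_mem_darts hd
    have hn := hp.edges_nodup
    rw [Walk.edges_append, Walk.edges_cons, List.nodup_append] at hn
    refine ⟨p₂.append p₁, by simp; omega, ?_, ?_⟩
    · rw [Walk.edges_append, List.mem_append, not_or]
      exact ⟨(List.nodup_cons.1 hn.2.1).1, fun h' => hn.2.2 _ h' _ List.mem_cons_self rfl⟩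
    · intro e he
      simp only [Walk.edges_append, Walk.edges_cons, List.mem_append, List.mem_cons] at he ⊢
      tauto
  obtain ⟨d, hd, hde⟩ := List.mem_map.1 h
  obtain ⟨q, hq, hq', hq''⟩ := key d hd
  rcases Sym2.eq_iff.1 (show s(d.fst, d.snd) = s(a, b) from hde) with ⟨h₁, h₂⟩ | ⟨h₁, h₂⟩
  · subst h₁ h₂
    exact ⟨q, hq, hq', hq''⟩
  · subst h₁ h₂
    refine ⟨q.reverse, by simpa using hq, ?_, by simpa using hq''⟩
    rw [Walk.edges_reverse, List.mem_reverse, ← hde]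
    exact hq'

/-- There is a walk of length at most `n` from `a` to `b` that does not use the edge `e`. -/
def JoinedAvoiding (H : SimpleGraph W) (e : Sym2 W) (n : ℕ) (a b : W) : Prop :=
  ∃ q : H.Walk a b, q.length ≤ n ∧ e ∉ q.edges

namespace JoinedAvoiding

variable {e : Sym2 W} {n m : ℕ} {a b c : W}

theorem of_eq (h : a = b) : JoinedAvoiding H e n a b := by
  subst h
  exact ⟨Walk.nil, by simp, by simp⟩

theorem of_adj (h : H.Adj a b) (he : s(a, b) ≠ e) : JoinedAvoiding H e (n + 1) a b :=
  ⟨Walk.cons h Walk.nil, by simp, by simpa using he.symm⟩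

theorem symm (h : JoinedAvoiding H e n a b) : JoinedAvoiding H e n b a := by
  obtain ⟨q, hq, hq'⟩ := h
  exact ⟨q.reverse, by simpa using hq, by simpa using hq'⟩

theorem trans (h : JoinedAvoiding H e n a b) (h' : JoinedAvoiding H e m b c) :
    JoinedAvoiding H e (n + m) a c := by
  obtain ⟨q, hq, hq'⟩ := h
  obtain ⟨r, hr, hr'⟩ := h'
  exact ⟨q.append r, by rw [Walk.length_append]; omega, by
    rw [Walk.edges_append, List.mem_append, not_or]; exact ⟨hq', hr'⟩⟩

theorem mono (h : JoinedAvoiding H e n a b) (hnm : n ≤ m) : JoinedAvoiding H e m a b := by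
  obtain ⟨q, hq, hq'⟩ := h
  exact ⟨q, hq.trans hnm, hq'⟩

/-- Shortening the walk to a path adds no edges, so closing it with `ab` gives a genuine cycle. -/
theorem egirth_le (h : JoinedAvoiding H s(a, b) n b a) (hab : H.Adj a b) :
    H.egirth ≤ (n + 1 : ℕ) := by
  classical
  obtain ⟨q, hq, hq'⟩ := h
  have hc : (Walk.cons hab q.bypass).IsCycle :=
    (Walk.cons_isCycle_iff _ _).2 ⟨q.bypass_isPath, fun h => hq' (q.edges_bypass_subset_edges h)⟩
  refine (egirth_le_length hc).trans ?_
  have := q.length_bypass_le_length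
  rw [Walk.length_cons]
  exact_mod_cast by omega

end JoinedAvoiding

/-- The map `f` need not be a homomorphism: edges may be collapsed or stretched to walks of length
`n`. -/
theorem Walk.joinedAvoiding_map (f : V → W) (e : Sym2 W) (n : ℕ) {x y : V} (p : G.Walk x y)
    (h : ∀ u v, G.Adj u v → s(u, v) ∈ p.edges → JoinedAvoiding H e n (f u) (f v)) :
    JoinedAvoiding H e (n * p.length) (f x) (f y) := by
  induction p with
  | nil => exact .of_eq rfl
  | cons hadj p ih =>
    refine ((h _ _ hadj (by simp)).trans (ih fun u v huv he => h u v huv ?_)).mono ?_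
    · simp [he]
    · rw [Walk.length_cons]; lia

/-- Used to show that a tree edge separates: a property that changes only across that edge is
constant along a walk avoiding it. -/
theorem Walk.iff_of_forall_edges (F : V → Prop) {x y : V} (p : G.Walk x y)
    (h : ∀ u v, G.Adj u v → s(u, v) ∈ p.edges → (F u ↔ F v)) : F x ↔ F y := by
  induction p with
  | nil => rfl
  | cons hadj p ih =>
    exact (h _ _ hadj (by simp)).trans (ih fun u v huv he => h u v huv (by simp [he]))

end SimpleGraph

open SimpleGraph

/-! ### Coding blocks of a word by single letters -/

section Chunk

variable {d N : ℕ}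

/-- The word of length `n` that codes the first `n` blocks of length `m`, counted from the root,
of a word. -/
def chunk (m : ℕ) (e : List (Fin d) → Fin N) : ℕ → List (Fin d) → List (Fin N)
  | 0, _ => []
  | n + 1, w => e ((w.drop (w.length - (n + 1) * m)).take m) :: chunk m e n w

variable (m : ℕ) (e : List (Fin d) → Fin N)

theorem length_chunk (n : ℕ) (w : List (Fin d)) : (chunk m e n w).length = n := by
  induction n with
  | zero => rfl
  | succ n ih => simp [chunk, ih]

/-- Blocks are counted from the root, which is the end of the list, so removing letters at the front
spares the first `n` blocks. -/
theorem chunk_drop {n j : ℕ} {w : List (Fin d)} (h : n * m + j ≤ w.length) :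
    chunk m e n (w.drop j) = chunk m e n w := by
  induction n with
  | zero => rfl
  | succ n ih =>
    have h' : n * m + m + j ≤ w.length := by rw [← Nat.succ_mul]; exact h
    rw [chunk, chunk, ih (by omega), List.drop_drop, List.length_drop]
    congr 4
    rw [Nat.succ_mul]; omega

theorem drop_chunk {n j : ℕ} (h : j ≤ n) (w : List (Fin d)) :
    (chunk m e n w).drop j = chunk m e (n - j) w := by
  induction j generalizing n with
  | zero => rfl
  | succ j ih =>
    obtain ⟨n, rfl⟩ : ∃ k, n = k + 1 := ⟨n - 1, by omega⟩
    rw [chunk, List.drop_succ_cons, ih (by omega)]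
    congr 1; omega

theorem drop_eq_of_chunk_eq
    (he : ∀ u w : List (Fin d), u.length = m → w.length = m → e u = e w → u = w) {n : ℕ}
    {u w : List (Fin d)} (hu : n * m ≤ u.length) (hw : n * m ≤ w.length)
    (h : chunk m e n u = chunk m e n w) :
    u.drop (u.length - n * m) = w.drop (w.length - n * m) := by
  induction n with
  | zero => simp
  | succ n ih =>
    rw [chunk, chunk, List.cons.injEq] at h
    have hs := Nat.succ_mul n m
    rw [Nat.succ_eq_add_one] at hs
    have h₁ := ih (by omega) (by omega) h.2
    have h₂ := he _ _ (by simp; omega) (by simp; omega) h.1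
    rw [← List.take_append_drop m (u.drop _), ← List.take_append_drop m (w.drop _), h₂,
      List.drop_drop, List.drop_drop]
    congr 1
    convert h₁ using 2 <;> omega

theorem exists_word_code (hd : 0 < d) (m : ℕ) : ∃ e : List (Fin d) → Fin (d ^ m),
    ∀ u w : List (Fin d), u.length = m → w.length = m → e u = e w → u = w := by
  have : NeZero (d ^ m) := ⟨(pow_pos hd m).ne'⟩
  have hc : Fintype.card (List.Vector (Fin d) m) = d ^ m := by simp
  let φ := Fintype.equivFinOfCardEq hc
  -- Only words of length `m` matter; the value `0` elsewhere is arbitrary.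
  refine ⟨fun u => if h : u.length = m then φ ⟨u, h⟩ else 0, fun u w hu hw h => ?_⟩
  have h' : φ ⟨u, hu⟩ = φ ⟨w, hw⟩ := by simpa only [hu, hw, dif_pos] using h
  exact congrArg Subtype.val (φ.injective h')

end Chunk

/-! ### Augmented trees -/

section AugmentedTree

variable {d m : ℕ} {D : List (Fin d) → Finset ℕ}

theorem augmentedTree_adj_cons {i : Fin d} {w : List (Fin d)} (h : (i :: w).length ≤ m)
    (h' : w.length ≤ m) : (augmentedTree d m D).Adj ⟨i :: w, h⟩ ⟨w, h'⟩ := by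
  refine (SimpleGraph.fromRel_adj _ _ _).2 ⟨fun h => ?_, .inl (.inl ⟨i, rfl⟩)⟩
  simpa using congrArg Subtype.val h

theorem augmentedTree_adj_drop {w : List (Fin d)} {j : ℕ} (h : w.length = m) (hj : j ∈ D w)
    (h0 : 0 < j) (hm : j ≤ m) (h₁ : w.length ≤ m) (h₂ : (w.drop j).length ≤ m) :
    (augmentedTree d m D).Adj ⟨w, h₁⟩ ⟨w.drop j, h₂⟩ := by
  refine (SimpleGraph.fromRel_adj _ _ _).2 ⟨fun h' => ?_, .inl (.inr ⟨h, j, hj, rfl⟩)⟩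
  have := congrArg List.length (congrArg Subtype.val h')
  simp at this
  omega

/-- Induction over the edges of an augmented tree, for a symmetric property. -/
theorem augmentedTree_adj_rec {P : {w : List (Fin d) // w.length ≤ m} →
      {w : List (Fin d) // w.length ≤ m} → Prop} (hP : ∀ u w, P u w → P w u)
    (tree : ∀ (i : Fin d) (w : List (Fin d)) (h : (i :: w).length ≤ m) (h' : w.length ≤ m),
      P ⟨i :: w, h⟩ ⟨w, h'⟩)
    (aug : ∀ (w : List (Fin d)) (j : ℕ) (h : w.length ≤ m) (h' : (w.drop j).length ≤ m),
      w.length = m → j ∈ D w → P ⟨w, h⟩ ⟨w.drop j, h'⟩)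
    {u w : {w : List (Fin d) // w.length ≤ m}} (h : (augmentedTree d m D).Adj u w) : P u w := by
  have key : ∀ u w : {w : List (Fin d) // w.length ≤ m}, ((∃ i : Fin d, u.1 = i :: w.1) ∨
      (u.1.length = m ∧ ∃ j ∈ D u.1, w.1 = u.1.drop j)) → P u w := by
    rintro ⟨u, hu⟩ ⟨w, hw⟩ (⟨i, h⟩ | ⟨h, j, hj, h'⟩)
    · obtain rfl : u = i :: w := h
      exact tree i w hu hw
    · obtain rfl : w = u.drop j := h'
      exact aug u j hu hw h hj
  rcases ((SimpleGraph.fromRel_adj _ _ _).1 h).2 with h | h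
  · exact key _ _ h
  · exact hP _ _ (key _ _ h)

/-- The two truncated differences add up to the difference of levels. It is `1` on tree edges and at
least `3` on the augmenting edges in question, which tells them apart. -/
theorem sym2_words_ne {u w u' w' : {w : List (Fin d) // w.length ≤ m}}
    (h : u.1.length - w.1.length + (w.1.length - u.1.length) ≠
      u'.1.length - w'.1.length + (w'.1.length - u'.1.length)) : s(u, w) ≠ s(u', w') := by
  intro h'
  rcases Sym2.eq_iff.1 h' with ⟨rfl, rfl⟩ | ⟨rfl, rfl⟩
  · exact h rfl
  · exact h (add_comm _ _)

theorem sym2_drop_inj {w w' : List (Fin d)} {j j' : ℕ} (hw : w.length = m) (hw' : w'.length = m)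
    (hj : 0 < j ∧ j ≤ m) (hj' : 0 < j' ∧ j' ≤ m) {h₁ : w.length ≤ m} {h₂ : (w.drop j).length ≤ m}
    {h₃ : w'.length ≤ m} {h₄ : (w'.drop j').length ≤ m}
    (h : s((⟨w, h₁⟩ : {w : List (Fin d) // w.length ≤ m}), ⟨w.drop j, h₂⟩) =
      s(⟨w', h₃⟩, ⟨w'.drop j', h₄⟩)) : w = w' ∧ j = j' := by
  rcases Sym2.eq_iff.1 h with ⟨h, h'⟩ | ⟨h, h'⟩
  · have := congrArg List.length (congrArg Subtype.val h')
    simp at this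
    exact ⟨congrArg Subtype.val h, by omega⟩
  · have := congrArg List.length (congrArg Subtype.val h)
    simp at this
    omega

/-- A cycle of an augmented tree contains an augmenting edge. -/
theorem exists_augmenting_edge {x : {w : List (Fin d) // w.length ≤ m}}
    {p : (augmentedTree d m D).Walk x x} (hp : p.IsCycle) :
    ∃ (w : List (Fin d)) (j : ℕ) (h : w.length ≤ m) (h' : (w.drop j).length ≤ m),
      w.length = m ∧ j ∈ D w ∧ s(⟨w, h⟩, ⟨w.drop j, h'⟩) ∈ p.edges := by
  by_contra! hno
  have tree : ∀ u w, (augmentedTree d m D).Adj u w → s(u, w) ∈ p.edges →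
      ∃ (i : Fin d) (v : List (Fin d)) (h : (i :: v).length ≤ m) (h' : v.length ≤ m),
        s(u, w) = s(⟨i :: v, h⟩, ⟨v, h'⟩) := by
    intro u w huw
    refine augmentedTree_adj_rec (P := fun u w => s(u, w) ∈ p.edges → ∃ (i : Fin d)
      (v : List (Fin d)) (h : (i :: v).length ≤ m) (h' : v.length ≤ m),
        s(u, w) = s(⟨i :: v, h⟩, ⟨v, h'⟩)) (fun u w h => ?_) (fun i w h h' _ => ?_)
      (fun w j h h' hw hj he => ?_) huw
    · rw [Sym2.eq_swap]; exact h
    · exact ⟨i, w, h, h', rfl⟩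
    · exact absurd he (hno w j h h' hw hj)
  obtain ⟨e, he⟩ : ∃ e, e ∈ p.edges := by
    apply List.exists_mem_of_ne_nil
    intro h
    have h₁ := congrArg List.length h
    rw [SimpleGraph.Walk.length_edges, List.length_nil] at h₁
    have := hp.three_le_length
    omega
  induction e using Sym2.ind with
  | _ a b =>
  obtain ⟨i, v, h, h', hab⟩ := tree a b (p.adj_of_mem_edges he) he
  rw [hab] at he
  obtain ⟨q, -, hq, hqp⟩ := hp.exists_walk_of_mem_edges he
  -- Lying below `i :: v` changes only across the deleted edge, yet the rest of the cycle joins its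
  -- two ends.
  have := q.iff_of_forall_edges (fun w => (i :: v) <:+ w.1) fun u w huw hmem => by
    obtain ⟨i', v', h₁, h₂, he'⟩ := tree u w huw (hqp hmem)
    have hne : i :: v ≠ i' :: v' := by
      rintro hh
      obtain ⟨rfl, rfl⟩ := List.cons.inj hh
      exact hq (he' ▸ hmem)
    have : (i :: v) <:+ (i' :: v') ↔ (i :: v) <:+ v' := by
      rw [List.suffix_cons_iff]
      exact or_iff_right hne
    rcases Sym2.eq_iff.1 he' with ⟨rfl, rfl⟩ | ⟨rfl, rfl⟩
    · exact this
    · exact this.symm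
  have h3 := (this.2 (List.suffix_refl _)).length_le
  simp at h3

/-- Each leaf has `r` augmenting edges, which lead to ancestors at odd distances other than `1`. -/
structure IsOddAugmentation (d r m : ℕ) (D : List (Fin d) → Finset ℕ) : Prop where
  card_eq : ∀ w : List (Fin d), w.length = m → (D w).card = r
  mem_bounds : ∀ w : List (Fin d), w.length = m → ∀ j ∈ D w, 3 ≤ j ∧ j ≤ m ∧ Odd j

theorem IsOddAugmentation.isBipartite {r : ℕ} (hD : IsOddAugmentation d r m D) :
    (augmentedTree d m D).IsBipartite := by
  refine ⟨SimpleGraph.Coloring.mk (fun w => if Even w.1.length then 0 else 1) fun {u w} huw => ?_⟩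
  have : ¬ (Even u.1.length ↔ Even w.1.length) := by
    refine augmentedTree_adj_rec (P := fun u w => ¬ (Even u.1.length ↔ Even w.1.length))
      (fun u w h => by tauto) (fun i w h h' => by
        simp only [List.length_cons, Nat.even_add_one]; tauto)
      (fun w j h h' hw hj => ?_) huw
    obtain ⟨-, hm, ho⟩ := hD.mem_bounds w hw j hj
    simp only [List.length_drop]
    rw [Nat.even_sub (by omega)]
    have := Nat.not_even_iff_odd.2 ho
    tauto
  by_cases h₁ : Even u.1.length <;> by_cases h₂ : Even w.1.length <;> simp_all

end AugmentedTree

/-! ### The extension step: one more augmenting edge per leaf -/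

section Extend

variable {d N : ℕ} (m₁ m₂ : ℕ) (D₁ : List (Fin d) → Finset ℕ) (e : List (Fin d) → Fin N)
  (β : List (Fin N) → Fin N → ℕ)

/-- The distance from a leaf of the extended tree to the upper end of its new edge. -/
def newDist (u : List (Fin d)) : ℕ :=
  (β (chunk m₁ e m₂ u) (e (u.take m₁)) + 1) * m₁ - 1

/-- Replace the stars of an `N`-ary augmented tree of height `m₂` by `d`-ary trees of height `m₁`,
append to each leaf a copy of the augmented tree given by `D₁`, and distribute the augmenting edges
among the leaves of that copy. -/
def extendAug (u : List (Fin d)) : Finset ℕ :=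
  insert (newDist m₁ m₂ e β u) (D₁ (u.take m₁))

/-- The map that contracts the extended tree to the `N`-ary tree. -/
def chunkMap (M : ℕ) (w : {w : List (Fin d) // w.length ≤ M}) :
    {w : List (Fin N) // w.length ≤ m₂} :=
  ⟨chunk m₁ e (min (w.1.length / m₁) m₂) w.1, by rw [length_chunk]; exact min_le_right _ _⟩

/-- The retraction of a tree to the subtree of height `m₁` at `v`. -/
def subtreeMap (M : ℕ) (v : List (Fin d)) (w : {w : List (Fin d) // w.length ≤ M}) :
    {w : List (Fin d) // w.length ≤ m₁} :=
  if h : v <:+ w.1 ∧ w.1.length ≤ m₁ + v.length then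
    ⟨w.1.take (w.1.length - v.length), by simp; omega⟩
  else ⟨[], by simp⟩

variable {m₁ m₂ D₁ e β}

/-- A tree edge is contracted unless its lower end completes a new block among the first `m₂`. -/
theorem chunkMap_cons {M : ℕ} (i : Fin d) (w : List (Fin d))
    (h : (i :: w).length ≤ M) (h' : w.length ≤ M) :
    chunkMap m₁ m₂ e M ⟨i :: w, h⟩ = chunkMap m₁ m₂ e M ⟨w, h'⟩ ∨
      ∃ c t h₁ h₂, chunkMap m₁ m₂ e M ⟨i :: w, h⟩ = ⟨c :: t, h₁⟩ ∧
        chunkMap m₁ m₂ e M ⟨w, h'⟩ = ⟨t, h₂⟩ := by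
  have hc : ∀ n, n * m₁ ≤ w.length → chunk m₁ e n (i :: w) = chunk m₁ e n w := fun n hn => by
    rw [← chunk_drop m₁ e (w := i :: w) (j := 1) (by simpa using hn)]; rfl
  have hq : w.length / m₁ * m₁ ≤ w.length := Nat.div_mul_le_self _ _
  have hmin : min (w.length / m₁) m₂ * m₁ ≤ w.length :=
    (Nat.mul_le_mul_right _ (min_le_left _ _)).trans hq
  have hsucc : (w.length + 1) / m₁ = w.length / m₁ ∨
      (w.length + 1) / m₁ = w.length / m₁ + 1 := by
    rw [Nat.succ_div]; split_ifs <;> simp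
  by_cases heq : min ((w.length + 1) / m₁) m₂ = min (w.length / m₁) m₂
  · left
    apply Subtype.ext
    simp only [chunkMap, List.length_cons, heq]
    exact hc _ hmin
  · right
    have hs : min ((w.length + 1) / m₁) m₂ = min (w.length / m₁) m₂ + 1 := by omega
    refine ⟨e (((i :: w).drop ((i :: w).length - (min (w.length / m₁) m₂ + 1) * m₁)).take m₁),
      (chunkMap m₁ m₂ e M ⟨w, h'⟩).1, ?_, (chunkMap m₁ m₂ e M ⟨w, h'⟩).2, ?_, rfl⟩
    · simp only [chunkMap, List.length_cons, length_chunk]; omega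
    · apply Subtype.ext
      simp only [chunkMap, List.length_cons, hs, chunk]
      rw [hc _ hmin]

theorem chunkMap_leaf {M : ℕ} {w : List (Fin d)} (h0 : 0 < m₁) (h : w.length ≤ M)
    (hw : m₂ * m₁ ≤ w.length) :
    chunkMap m₁ m₂ e M ⟨w, h⟩ = ⟨chunk m₁ e m₂ w, (length_chunk _ _ _ _).le⟩ := by
  apply Subtype.ext
  simp only [chunkMap]
  rw [min_eq_right ((Nat.le_div_iff_mul_le h0).2 hw)]

theorem chunkMap_drop {M j : ℕ} {w : List (Fin d)} (h0 : 0 < m₁) (h : w.length ≤ M)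
    (h' : (w.drop j).length ≤ M) (hw : m₂ * m₁ + j ≤ w.length) :
    chunkMap m₁ m₂ e M ⟨w.drop j, h'⟩ = chunkMap m₁ m₂ e M ⟨w, h⟩ := by
  rw [chunkMap_leaf h0 _ (by simp; omega), chunkMap_leaf h0 _ (by omega)]
  exact Subtype.ext (chunk_drop _ _ hw)

/-- The upper end of a new edge lies one step below a block boundary, which makes its distance odd.
As `m₁ ≥ 2`, no further block is completed there, and the vertex contracts to the boundary vertex.
-/
theorem chunkMap_drop_newDist {M : ℕ} {u : List (Fin d)} {j : ℕ} (h2 : 2 ≤ m₁)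
    (hu : u.length = (m₂ + 1) * m₁) (hj : β (chunk m₁ e m₂ u) (e (u.take m₁)) = j) (hjm : j ≤ m₂)
    (h : (u.drop (newDist m₁ m₂ e β u)).length ≤ M) :
    chunkMap m₁ m₂ e M ⟨u.drop (newDist m₁ m₂ e β u), h⟩ =
      ⟨(chunk m₁ e m₂ u).drop j, by simp [length_chunk]⟩ := by
  apply Subtype.ext
  obtain ⟨i, rfl⟩ := Nat.exists_eq_add_of_le hjm
  have hmul : (j + i + 1) * m₁ = (j + 1) * m₁ + i * m₁ := by ring
  have hpos : m₁ ≤ (j + 1) * m₁ := Nat.le_mul_of_pos_left _ (by omega)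
  have hlen : (u.drop (newDist m₁ (j + i) e β u)).length = 1 + i * m₁ := by
    rw [List.length_drop, newDist, hj, hu]; omega
  simp only [chunkMap]
  rw [hlen, Nat.add_mul_div_right _ _ (by omega), Nat.div_eq_of_lt (by omega), zero_add,
    min_eq_left (by omega), chunk_drop, drop_chunk _ _ (by omega), Nat.add_sub_cancel_left]
  rw [newDist, hj, hu]; omega

theorem subtreeMap_of_suffix {M : ℕ} {v t : List (Fin d)} (h : (t ++ v).length ≤ M)
    (ht : t.length ≤ m₁) : subtreeMap m₁ M v ⟨t ++ v, h⟩ = ⟨t, ht⟩ := by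
  rw [subtreeMap, dif_pos ⟨List.suffix_append t v, by simpa using ht⟩]
  simp

theorem subtreeMap_of_not_suffix {M : ℕ} {v w : List (Fin d)} (h : w.length ≤ M)
    (hv : ¬ v <:+ w) : subtreeMap m₁ M v ⟨w, h⟩ = ⟨[], by simp⟩ := by
  rw [subtreeMap, dif_neg fun h' => hv h'.1]

theorem subtreeMap_cons {M : ℕ} {v : List (Fin d)} (hM : M ≤ m₁ + v.length) (i : Fin d)
    (w : List (Fin d)) (h : (i :: w).length ≤ M) (h' : w.length ≤ M) :
    subtreeMap m₁ M v ⟨i :: w, h⟩ = subtreeMap m₁ M v ⟨w, h'⟩ ∨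
      ∃ t h₁ h₂, subtreeMap m₁ M v ⟨i :: w, h⟩ = ⟨i :: t, h₁⟩ ∧
        subtreeMap m₁ M v ⟨w, h'⟩ = ⟨t, h₂⟩ := by
  by_cases hw : v <:+ w
  · obtain ⟨t, rfl⟩ := hw
    simp only [List.length_cons, List.length_append] at h
    right
    exact ⟨t, by simp; omega, by omega,
      subtreeMap_of_suffix (t := i :: t) _ (by simp; omega), subtreeMap_of_suffix _ _⟩
  · left
    rw [subtreeMap_of_not_suffix _ hw]
    by_cases hiw : v = i :: w
    · subst hiw
      exact subtreeMap_of_suffix (t := []) _ (by simp)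
    · refine subtreeMap_of_not_suffix _ fun hs => ?_
      rcases List.suffix_cons_iff.1 hs with hs | hs
      · exact hiw hs
      · exact hw hs

theorem isOddAugmentation_extendAug {r : ℕ} (h2 : 2 ≤ m₁) (hD₁ : IsOddAugmentation d r m₁ D₁)
    (hβ : ∀ w c, w.length = m₂ → 3 ≤ β w c ∧ β w c ≤ m₂ ∧ Odd (β w c)) :
    IsOddAugmentation d (r + 1) ((m₂ + 1) * m₁) (extendAug m₁ m₂ D₁ e β) := by
  -- As `β ≥ 3`, the new distance exceeds `m₁`, so it differs from all distances in `D₁`. It is odd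
  -- because `j + 1` is even.
  have hnew : ∀ w : List (Fin d), 4 * m₁ ≤ newDist m₁ m₂ e β w + 1 ∧
      newDist m₁ m₂ e β w < (m₂ + 1) * m₁ ∧ Odd (newDist m₁ m₂ e β w) := fun w => by
    obtain ⟨hj3, hjm, hjo⟩ := hβ (chunk m₁ e m₂ w) (e (w.take m₁)) (length_chunk _ _ _ _)
    rw [newDist]
    generalize β (chunk m₁ e m₂ w) (e (w.take m₁)) = j at *
    have h₁ : 4 * m₁ ≤ (j + 1) * m₁ := Nat.mul_le_mul_right _ (by omega)
    have h₂ : (j + 1) * m₁ ≤ (m₂ + 1) * m₁ := Nat.mul_le_mul_right _ (by omega)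
    refine ⟨by omega, by omega, ?_⟩
    exact Nat.Even.sub_odd (by omega) ((hjo.add_odd odd_one).mul_right _) odd_one
  have htake : ∀ w : List (Fin d), w.length = (m₂ + 1) * m₁ → (w.take m₁).length = m₁ :=
    fun w hw => by
      rw [List.length_take, hw, min_eq_left (Nat.le_mul_of_pos_left _ (by omega))]
  refine ⟨fun w hw => ?_, fun w hw j hj => ?_⟩
  · rw [extendAug, Finset.card_insert_of_notMem, hD₁.card_eq _ (htake w hw)]
    intro hmem
    have := hD₁.mem_bounds _ (htake w hw) _ hmem
    have := hnew w
    omega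
  · have := hnew w
    rcases Finset.mem_insert.1 hj with rfl | hj
    · exact ⟨by omega, by omega, this.2.2⟩
    · have := hD₁.mem_bounds _ (htake w hw) _ hj
      exact ⟨this.1, by omega, this.2.2⟩

/-- For a cycle through a new edge at `u`, the other cycle edge at `u` stays inside the hanging copy
and is contracted. This gains the one edge between `g` and `g + 1`. -/
theorem egirth_extendAug {r g : ℕ} {D₂ : List (Fin N) → Finset ℕ} (h2 : 2 ≤ m₁)
    (hD₁ : IsOddAugmentation d r m₁ D₁) (hg₁ : ((g + 1 : ℕ) : ℕ∞) ≤ (augmentedTree d m₁ D₁).egirth)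
    (hg₂ : (g : ℕ∞) ≤ (augmentedTree N m₂ D₂).egirth)
    (hβ : ∀ w c, w.length = m₂ → 3 ≤ β w c ∧ β w c ≤ m₂ ∧ Odd (β w c))
    (hβD : ∀ w c, w.length = m₂ → β w c ∈ D₂ w)
    (hβi : ∀ w, w.length = m₂ → Function.Injective (β w))
    (he : ∀ u w : List (Fin d), u.length = m₁ → w.length = m₁ → e u = e w → u = w) :
    ((g + 1 : ℕ) : ℕ∞) ≤
      (augmentedTree d ((m₂ + 1) * m₁) (extendAug m₁ m₂ D₁ e β)).egirth := by
  set M := (m₂ + 1) * m₁ with hM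
  have hM' : M = m₂ * m₁ + m₁ := by rw [hM]; ring
  have htake : ∀ w : List (Fin d), w.length = M → (w.take m₁).length = m₁ := fun w hw => by
    rw [List.length_take, hw]; omega
  have hadj : ∀ u (hu : u.length = M) h₁ h₂, (augmentedTree N m₂ D₂).Adj
      ⟨chunk m₁ e m₂ u, h₁⟩ ⟨(chunk m₁ e m₂ u).drop (β (chunk m₁ e m₂ u) (e (u.take m₁))), h₂⟩ :=
    fun u hu h₁ h₂ => by
      have hl := length_chunk m₁ e m₂ u
      have := hβ (chunk m₁ e m₂ u) (e (u.take m₁)) hl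
      exact augmentedTree_adj_drop hl (hβD _ _ hl) (by omega) (by omega) _ _
  rw [SimpleGraph.le_egirth]
  intro x p hp
  by_cases hnew : ∃ (u : List (Fin d)) (h : u.length ≤ M)
      (h' : (u.drop (newDist m₁ m₂ e β u)).length ≤ M), u.length = M ∧
      s(⟨u, h⟩, ⟨u.drop (newDist m₁ m₂ e β u), h'⟩) ∈ p.edges
  · obtain ⟨u, hu₁, hu₂, hu, hup⟩ := hnew
    set j := β (chunk m₁ e m₂ u) (e (u.take m₁)) with hj
    have hl := length_chunk m₁ e m₂ u
    have hjb := hβ (chunk m₁ e m₂ u) (e (u.take m₁)) hl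
    rw [← hj] at hjb
    have hd₁ : (chunk m₁ e m₂ u).length ≤ m₂ := by omega
    have hd₂ : ((chunk m₁ e m₂ u).drop j).length ≤ m₂ := by rw [List.length_drop]; omega
    have hfu : chunkMap m₁ m₂ e M ⟨u, hu₁⟩ = ⟨chunk m₁ e m₂ u, hd₁⟩ :=
      chunkMap_leaf (by omega) _ (by omega)
    have hft : chunkMap m₁ m₂ e M ⟨u.drop (newDist m₁ m₂ e β u), hu₂⟩ =
        ⟨(chunk m₁ e m₂ u).drop j, hd₂⟩ := chunkMap_drop_newDist h2 hu rfl (by omega) _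
    have joined : ∀ a b, (augmentedTree d M (extendAug m₁ m₂ D₁ e β)).Adj a b →
        s(a, b) ≠ s(⟨u, hu₁⟩, ⟨u.drop (newDist m₁ m₂ e β u), hu₂⟩) →
        SimpleGraph.JoinedAvoiding (augmentedTree N m₂ D₂)
          s(⟨chunk m₁ e m₂ u, hd₁⟩, ⟨(chunk m₁ e m₂ u).drop j, hd₂⟩) 1
          (chunkMap m₁ m₂ e M a) (chunkMap m₁ m₂ e M b) := by
      intro a b hab
      refine augmentedTree_adj_rec (P := fun a b =>
        s(a, b) ≠ s(⟨u, hu₁⟩, ⟨u.drop (newDist m₁ m₂ e β u), hu₂⟩) →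
        SimpleGraph.JoinedAvoiding (augmentedTree N m₂ D₂)
          s(⟨chunk m₁ e m₂ u, hd₁⟩, ⟨(chunk m₁ e m₂ u).drop j, hd₂⟩) 1
          (chunkMap m₁ m₂ e M a) (chunkMap m₁ m₂ e M b)) (fun a b h => ?_)
        (fun i w h h' hne => ?_) (fun w i h h' hw hi hne => ?_) hab
      · rw [Sym2.eq_swap]; exact fun hne => (h hne).symm
      · rcases chunkMap_cons (m₁ := m₁) (m₂ := m₂) (e := e) i w h h' with heq |
          ⟨c, t, h₁, h₂, h₃, h₄⟩
        · exact .of_eq heq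
        · rw [h₃, h₄]
          refine .of_adj (augmentedTree_adj_cons _ _) (sym2_words_ne ?_)
          simp only [List.length_cons, List.length_drop]
          omega
      · rcases Finset.mem_insert.1 hi with rfl | hi
        · have hl' := length_chunk m₁ e m₂ w
          have hjb' := hβ (chunk m₁ e m₂ w) (e (w.take m₁)) hl'
          rw [chunkMap_leaf (by omega) _ (by omega),
            chunkMap_drop_newDist h2 hw rfl (by omega)]
          refine .of_adj (hadj w hw _ _) fun heq => ?_
          -- Distinct new edges have distinct images: equal images give the same `N`-ary leaf and,
          -- by injectivity of `β` and `e`, the same position in the copy below it.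
          obtain ⟨h₁, h₂⟩ := sym2_drop_inj hl' hl (by omega) (by omega) heq
          rw [hj, h₁] at h₂
          have h₃ := he _ _ (htake w hw) (htake u hu) (hβi _ hl h₂)
          have h₄ := drop_eq_of_chunk_eq m₁ e he (by omega) (by omega) h₁
          rw [hw, hu, hM', Nat.add_sub_cancel_left] at h₄
          have h₅ : w = u := by rw [← List.take_append_drop m₁ w, h₃, h₄, List.take_append_drop]
          subst h₅
          exact hne rfl
        · have := hD₁.mem_bounds _ (htake w hw) _ hi
          exact .of_eq (chunkMap_drop (by omega) _ _ (by omega)).symm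
    have contracted : ∀ a b, (augmentedTree d M (extendAug m₁ m₂ D₁ e β)).Adj a b →
        s(a, b) ≠ s(⟨u, hu₁⟩, ⟨u.drop (newDist m₁ m₂ e β u), hu₂⟩) →
        a = ⟨u, hu₁⟩ ∨ b = ⟨u, hu₁⟩ → chunkMap m₁ m₂ e M a = chunkMap m₁ m₂ e M b := by
      intro a b hab
      refine augmentedTree_adj_rec (P := fun a b =>
        s(a, b) ≠ s(⟨u, hu₁⟩, ⟨u.drop (newDist m₁ m₂ e β u), hu₂⟩) →
        a = ⟨u, hu₁⟩ ∨ b = ⟨u, hu₁⟩ → chunkMap m₁ m₂ e M a = chunkMap m₁ m₂ e M b)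
        (fun a b h => ?_) (fun i w h h' _ hau => ?_) (fun w i h h' hw hi hne hau => ?_) hab
      · rw [Sym2.eq_swap]; exact fun hne hau => (h hne hau.symm).symm
      · have hw : M ≤ w.length + 1 := by
          rcases hau with hau | hau <;> have := congrArg List.length (congrArg Subtype.val hau) <;>
            simp at this <;> omega
        exact (chunkMap_drop (w := i :: w) (j := 1) (by omega) h h' (by simp; omega)).symm
      · rcases Finset.mem_insert.1 hi with rfl | hi
        · refine absurd ?_ hne
          rcases hau with hau | hau
          · obtain rfl : w = u := congrArg Subtype.val hau
            rfl
          · have := congrArg List.length (congrArg Subtype.val hau)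
            have := (isOddAugmentation_extendAug h2 hD₁ hβ).mem_bounds w hw _ hi
            simp at *
            omega
        · have := hD₁.mem_bounds _ (htake w hw) _ hi
          exact (chunkMap_drop (by omega) _ _ (by omega)).symm
    rw [Sym2.eq_swap] at hup
    obtain ⟨q, hq, hqe, -⟩ := hp.exists_walk_of_mem_edges hup
    rw [Sym2.eq_swap] at hqe
    obtain ⟨y, hy, q', rfl⟩ := SimpleGraph.Walk.exists_eq_cons_of_ne
      (p.adj_of_mem_edges hup).ne.symm q
    rw [SimpleGraph.Walk.edges_cons, List.mem_cons, not_or] at hqe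
    -- The first step of the walk from `u` costs nothing after contraction.
    have hyu := contracted _ _ hy (Ne.symm hqe.1) (.inl rfl)
    have hj' := q'.joinedAvoiding_map (chunkMap m₁ m₂ e M) _ 1 fun a b hab hmem =>
      joined a b hab fun heq => hqe.2 (heq ▸ hmem)
    rw [← hyu, hfu, hft] at hj'
    rw [Sym2.eq_swap] at hj'
    have := hg₂.trans (hj'.egirth_le (hadj u hu _ _).symm)
    rw [SimpleGraph.Walk.length_cons] at hq
    norm_cast at this ⊢
    omega
  -- Without new edges, the cycle has an edge from `D₁`; project to the copy containing it.
  · obtain ⟨u, j, hu₁, hu₂, hu, hj, hup⟩ := exists_augmenting_edge hp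
    have old : ∀ w i h h', w.length = M → i ∈ extendAug m₁ m₂ D₁ e β w →
        s((⟨w, h⟩ : {w : List (Fin d) // w.length ≤ M}), ⟨w.drop i, h'⟩) ∈ p.edges →
        i ∈ D₁ (w.take m₁) := fun w i h h' hw hi hmem => by
      rcases Finset.mem_insert.1 hi with rfl | hi
      · exact absurd ⟨w, h, h', hw, hmem⟩ hnew
      · exact hi
    have hsub : ∀ w i (h₁ : w.length ≤ M) (h₂ : (w.drop i).length ≤ M) (hw : w.length = M),
        i ≤ m₁ → subtreeMap m₁ M (w.drop m₁) ⟨w, h₁⟩ = ⟨w.take m₁, (htake w hw).le⟩ ∧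
          subtreeMap m₁ M (w.drop m₁) ⟨w.drop i, h₂⟩ = ⟨(w.take m₁).drop i, by simp⟩ := by
      intro w i h₁ h₂ hw hi
      constructor
      · have := subtreeMap_of_suffix (m₁ := m₁) (M := M) (v := w.drop m₁) (t := w.take m₁)
          (by simpa using h₁) (htake w hw).le
        simpa only [List.take_append_drop] using this
      · have heq : w.drop i = (w.take m₁).drop i ++ w.drop m₁ := by
          conv_lhs => rw [← List.take_append_drop m₁ w]
          rw [List.drop_append_of_le_length (by rw [htake w hw]; exact hi)]
        simp only [heq]
        exact subtreeMap_of_suffix _ _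
    have hj' := old u j hu₁ hu₂ hu hj hup
    have hjb := hD₁.mem_bounds _ (htake u hu) _ hj'
    obtain ⟨hs₁, hs₂⟩ := hsub u j hu₁ hu₂ hu hjb.2.1
    obtain ⟨q, hq, hqe, hqp⟩ := hp.exists_walk_of_mem_edges hup
    have hlen : (u.drop m₁).length = m₂ * m₁ := by rw [List.length_drop]; omega
    have h₁ : (u.take m₁).length ≤ m₁ := (htake u hu).le
    have h₂ : ((u.take m₁).drop j).length ≤ m₁ := by rw [List.length_drop]; omega
    have joined : ∀ a b, (augmentedTree d M (extendAug m₁ m₂ D₁ e β)).Adj a b →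
        s(a, b) ∈ q.edges → SimpleGraph.JoinedAvoiding (augmentedTree d m₁ D₁)
          s(⟨u.take m₁, h₁⟩, ⟨(u.take m₁).drop j, h₂⟩) 1
          (subtreeMap m₁ M (u.drop m₁) a) (subtreeMap m₁ M (u.drop m₁) b) := by
      intro a b hab
      refine augmentedTree_adj_rec (P := fun a b =>
        s(a, b) ∈ q.edges → SimpleGraph.JoinedAvoiding (augmentedTree d m₁ D₁)
          s(⟨u.take m₁, h₁⟩, ⟨(u.take m₁).drop j, h₂⟩) 1
          (subtreeMap m₁ M (u.drop m₁) a) (subtreeMap m₁ M (u.drop m₁) b)) (fun a b h => ?_)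
        (fun i w h h' hmem => ?_) (fun w i h h' hw hi hmem => ?_) hab
      · rw [Sym2.eq_swap]; exact fun hmem => (h hmem).symm
      · rcases subtreeMap_cons (m₁ := m₁) (v := u.drop m₁) (by omega) i w h h' with
          heq | ⟨t, h₃, h₄, h₅, h₆⟩
        · exact .of_eq heq
        · rw [h₅, h₆]
          refine .of_adj (augmentedTree_adj_cons _ _) (sym2_words_ne ?_)
          have := htake u hu
          simp only [List.length_cons, List.length_drop]
          omega
      · have hi' := old w i h h' hw hi (hqp hmem)
        have hib := hD₁.mem_bounds _ (htake w hw) _ hi'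
        by_cases hwu : w.drop m₁ = u.drop m₁
        · obtain ⟨hw₁, hw₂⟩ := hsub w i h h' hw hib.2.1
          rw [← hwu, hw₁, hw₂]
          refine .of_adj (augmentedTree_adj_drop (htake w hw) hi' (by omega) hib.2.1 _ _)
            fun heq => hqe ?_
          obtain ⟨h₃, rfl⟩ := sym2_drop_inj (htake w hw) (htake u hu) (by omega) (by omega) heq
          have h₅ : w = u := by
            rw [← List.take_append_drop m₁ w, h₃, hwu, List.take_append_drop]
          subst h₅
          exact hmem
        -- An old edge in another copy has both ends outside the subtree at `u.drop m₁`, so it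
        -- collapses to the root.
        · have hns : ∀ n ≤ m₁, ¬ u.drop m₁ <:+ w.drop n := fun n hn hs => by
            refine hwu (List.IsSuffix.eq_of_length ?_ (by simp; omega)).symm
            exact List.suffix_of_suffix_length_le (hs.trans (List.drop_suffix _ _))
              (List.drop_suffix _ _) (by simp; omega)
          refine .of_eq ?_
          rw [subtreeMap_of_not_suffix _ (hns i hib.2.1),
            subtreeMap_of_not_suffix _ (by simpa using hns 0 (by omega))]
    have hj'' := q.joinedAvoiding_map (subtreeMap m₁ M (u.drop m₁)) _ 1 joined
    rw [hs₁, hs₂] at hj''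
    have := hg₁.trans (hj''.egirth_le
      (augmentedTree_adj_drop (htake u hu) hj' (by omega) hjb.2.1 _ _))
    norm_cast at this ⊢
    omega

end Extend

/-! ### Existence of augmented trees, and parity of their edges -/

theorem exists_oddAugmentation (g d r : ℕ) (hd : 0 < d) :
    ∃ (m : ℕ) (D : List (Fin d) → Finset ℕ), 2 ≤ m ∧ IsOddAugmentation d r m D ∧
      (g : ℕ∞) ≤ (augmentedTree d m D).egirth := by
  induction g generalizing d r with
  | zero =>
    -- No girth is required, so the distances `3, 5, …, 2r + 1` will do.
    refine ⟨2 * r + 2, fun _ => (Finset.range r).image (2 * · + 3), by omega,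
      ⟨fun w _ => ?_, fun w _ j hj => ?_⟩, by simp⟩
    · rw [Finset.card_image_of_injective _ fun a b h => by simpa using h, Finset.card_range]
    · obtain ⟨i, hi, rfl⟩ := Finset.mem_image.1 hj
      have := Finset.mem_range.1 hi
      exact ⟨by omega, by omega, ⟨i + 1, by omega⟩⟩
  | succ g ihg =>
    induction r with
    | zero =>
      refine ⟨2, fun _ => ∅, le_rfl, ⟨by simp, by simp⟩, ?_⟩
      rw [SimpleGraph.le_egirth]
      intro x p hp
      obtain ⟨w, j, -, -, -, hj, -⟩ := exists_augmenting_edge hp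
      simp at hj
    | succ r ihr =>
      obtain ⟨m₁, D₁, h2, hD₁, hg₁⟩ := ihr
      -- Both the arity and the number of augmenting edges are the number of leaves of the tree of
      -- height `m₁`. Hence the outer induction has to be over all `d` and `r`.
      obtain ⟨m₂, D₂, -, hD₂, hg₂⟩ := ihg (d ^ m₁) (d ^ m₁) (pow_pos hd _)
      obtain ⟨e, he⟩ := exists_word_code hd m₁
      let β : List (Fin (d ^ m₁)) → Fin (d ^ m₁) → ℕ := fun w c =>
        if h : w.length = m₂ then (D₂ w).orderEmbOfFin (hD₂.card_eq w h) c else 0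
      have hβ : ∀ w c, w.length = m₂ → β w c ∈ D₂ w := fun w c h => by
        simp only [β, h, dif_pos]
        exact Finset.orderEmbOfFin_mem _ _ _
      have hβb := fun w c h => hD₂.mem_bounds w h _ (hβ w c h)
      exact ⟨(m₂ + 1) * m₁, extendAug m₁ m₂ D₁ e β, h2.trans (Nat.le_mul_of_pos_left _ (by omega)),
        isOddAugmentation_extendAug h2 hD₁ hβb,
        egirth_extendAug h2 hD₁ hg₁ hg₂ hβb hβ (fun w h c c' hcc => by
          simpa [β, h] using hcc) he⟩

theorem exists_isAugmentedTreeGraph (d r g : ℕ) (hd : 0 < d) :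
    ∃ (m : ℕ) (D : List (Fin d) → Finset ℕ), 0 < m ∧ IsAugmentedTreeGraph d r g m D := by
  obtain ⟨m, D, h2, hD, hg⟩ := exists_oddAugmentation g d r hd
  refine ⟨m, D, by omega, hD.card_eq, fun w hw j hj => ?_, hD.isBipartite, hg⟩
  have := hD.mem_bounds w hw j hj
  omega

/-- A 2-colouring alternates on the path from a leaf to the root, so augmenting distances are odd;
being at least `2`, they are at least `3`. -/
theorem IsAugmentedTreeGraph.isOddAugmentation {d r g m : ℕ} {D : List (Fin d) → Finset ℕ}
    (hD : IsAugmentedTreeGraph d r g m D) : IsOddAugmentation d r m D := by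
  obtain ⟨c⟩ := hD.bipartite
  refine ⟨hD.card_eq, fun w hw j hj => ?_⟩
  obtain ⟨hj2, hjm⟩ := hD.mem_bounds w hw j hj
  have key : ∀ i (h : (w.drop i).length ≤ m), i ≤ m →
      (c ⟨w.drop i, h⟩ = c ⟨w, hw.le⟩ ↔ Even i) := by
    intro i
    induction i with
    | zero => simp
    | succ i ih =>
      intro h him
      have h' : (w.drop i).length ≤ m := by simp; omega
      have ih := ih h' (by omega)
      have hcons : w.drop i = w[i] :: w.drop (i + 1) := List.drop_eq_getElem_cons (by omega)
      have hadj := c.valid (augmentedTree_adj_cons (D := D) (i := w[i]) (by rw [← hcons]; exact h') h)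
      simp only [← hcons] at hadj
      rw [Nat.even_add_one, ← ih]
      generalize c ⟨w.drop i, h'⟩ = x at *
      generalize c ⟨w.drop (i + 1), h⟩ = y at *
      generalize c ⟨w, hw.le⟩ = z at *
      revert x y z
      omega
  have h : (w.drop j).length ≤ m := by simp; omega
  have hodd : Odd j := by
    rw [← Nat.not_even_iff_odd, ← key j h hjm]
    exact (c.valid (augmentedTree_adj_drop hw hj (by omega) hjm hw.le h)).symm
  obtain ⟨t, rfl⟩ := hodd
  exact ⟨by omega, hjm, ⟨t, rfl⟩⟩

/-! ### Attaching copies: bipartiteness and girth -/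

section AttachCopies

variable {V : Type} {G : SimpleGraph V} {ρ : V} {d m : ℕ} {c : V → Bool}
  {β : ReducedLeaf d m → V → ℕ}

open Classical in
/-- The distance from the leaf `v` to the upper end of the edge leading from the copy of `x` at `v`
to the tree. -/
noncomputable def upDist {L : Type} (ρ : V) (c : V → Bool) (β : L → V → ℕ) (v : L) (x : V) : ℕ :=
  attachDist ρ c β v x

theorem upDist_root (v : ReducedLeaf d m) : upDist ρ c β v ρ = 1 := by
  simp [upDist, attachDist]

theorem upDist_of_eq {v : ReducedLeaf d m} {x : V} (hx : x ≠ ρ) (hc : c x = c ρ) :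
    upDist ρ c β v x = β v x := by
  simp [upDist, attachDist, hx, hc]

theorem upDist_of_ne {v : ReducedLeaf d m} {x : V} (hx : x ≠ ρ) (hc : c x ≠ c ρ) :
    upDist ρ c β v x = β v x - 1 := by
  simp [upDist, attachDist, hx, hc]

theorem attachCopies_adj_tree (u w : ReducedInner d m) {i : Fin d} (h : u.1 = i :: w.1) :
    (attachCopies G ρ d m c β).Adj (Sum.inl u) (Sum.inl w) := by
  refine (SimpleGraph.fromRel_adj _ _ _).2 ⟨fun h' => ?_, .inl ⟨i, h⟩⟩
  rw [Sum.inl.inj h'] at h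
  simpa using congrArg List.length h

theorem attachCopies_adj_up (v : ReducedLeaf d m) (x : V) (w : ReducedInner d m)
    (h : w.1 = v.1.drop (upDist ρ c β v x)) :
    (attachCopies G ρ d m c β).Adj (Sum.inr (v, x)) (Sum.inl w) :=
  (SimpleGraph.fromRel_adj _ _ _).2 ⟨Sum.inr_ne_inl, .inl h⟩

theorem attachCopies_adj_copy (v : ReducedLeaf d m) {x y : V} (h : G.Adj x y) :
    (attachCopies G ρ d m c β).Adj (Sum.inr (v, x)) (Sum.inr (v, y)) :=
  (SimpleGraph.fromRel_adj _ _ _).2 ⟨fun h' => h.ne (Prod.mk.inj (Sum.inr.inj h')).2,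
    .inl ⟨rfl, h⟩⟩

/-- Induction over the edges of `attachCopies`, for a symmetric property. -/
theorem attachCopies_adj_rec
    {P : ReducedInner d m ⊕ ReducedLeaf d m × V → ReducedInner d m ⊕ ReducedLeaf d m × V → Prop}
    (hP : ∀ p q, P p q → P q p)
    (tree : ∀ (u w : ReducedInner d m) (i : Fin d), u.1 = i :: w.1 → P (Sum.inl u) (Sum.inl w))
    (up : ∀ (v : ReducedLeaf d m) (x : V) (w : ReducedInner d m),
      w.1 = v.1.drop (upDist ρ c β v x) → P (Sum.inr (v, x)) (Sum.inl w))
    (copy : ∀ (v : ReducedLeaf d m) (x y : V), G.Adj x y → P (Sum.inr (v, x)) (Sum.inr (v, y)))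
    {p q : ReducedInner d m ⊕ ReducedLeaf d m × V} (h : (attachCopies G ρ d m c β).Adj p q) :
    P p q := by
  have h' := ((SimpleGraph.fromRel_adj _ _ _).1 h).2
  rcases p with u | ⟨v, x⟩ <;> rcases q with w | ⟨v', y⟩
  · rcases h' with ⟨i, h'⟩ | ⟨i, h'⟩
    · exact tree u w i h'
    · exact hP _ _ (tree w u i h')
  · rcases h' with h' | h'
    · exact h'.elim
    · exact hP _ _ (up v' y u h')
  · rcases h' with h' | h'
    · exact up v x w h'
    · exact h'.elim
  · rcases h' with ⟨rfl, h'⟩ | ⟨rfl, h'⟩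
    · exact copy _ x y h'
    · exact hP _ _ (copy _ y x h')

section

variable {r : ℕ} {D : List (Fin d) → Finset ℕ}

theorem beta_bounds (hD : IsOddAugmentation d r m D)
    (hβ : ∀ v, Set.BijOn (β v) {x | x ≠ ρ} (D v.1 : Set ℕ)) (v : ReducedLeaf d m) {x : V}
    (hx : x ≠ ρ) : β v x ∈ D v.1 ∧ 3 ≤ β v x ∧ β v x ≤ m ∧ Odd (β v x) := by
  have h := (hβ v).mapsTo hx
  exact ⟨h, hD.mem_bounds _ v.2.1 _ h⟩

theorem upDist_bounds (hm : 0 < m) (hD : IsOddAugmentation d r m D)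
    (hβ : ∀ v, Set.BijOn (β v) {x | x ≠ ρ} (D v.1 : Set ℕ)) (v : ReducedLeaf d m) (x : V) :
    1 ≤ upDist ρ c β v x ∧ upDist ρ c β v x ≤ m ∧ (Odd (upDist ρ c β v x) ↔ c x = c ρ) := by
  by_cases hx : x = ρ
  · subst hx
    simpa [upDist_root] using Nat.succ_le_of_lt hm
  · obtain ⟨-, h3, hm', ho⟩ := beta_bounds hD hβ v hx
    by_cases hc : c x = c ρ
    · rw [upDist_of_eq hx hc]
      exact ⟨by omega, hm', by simp [hc, ho]⟩
    · rw [upDist_of_ne hx hc]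
      refine ⟨by omega, by omega, iff_of_false ?_ hc⟩
      rw [Nat.not_odd_iff_even]
      exact Nat.Odd.sub_odd ho odd_one

/-- Distances are odd on the part of `ρ` and even on the other, and within a part `β` is injective;
`β ≥ 3` keeps them off the distance `1` of the root. This makes the path colours added to the lists
of one copy distinct. -/
theorem upDist_injective (hm : 0 < m) (hD : IsOddAugmentation d r m D)
    (hβ : ∀ v, Set.BijOn (β v) {x | x ≠ ρ} (D v.1 : Set ℕ)) (v : ReducedLeaf d m) :
    Function.Injective (upDist ρ c β v) := by
  intro x y h
  have hcxy : c x = c ρ ↔ c y = c ρ := by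
    rw [← (upDist_bounds (c := c) hm hD hβ v x).2.2, h, (upDist_bounds hm hD hβ v y).2.2]
  by_cases hx : x = ρ <;> by_cases hy : y = ρ
  · rw [hx, hy]
  · have := beta_bounds hD hβ v hy
    rw [hx, upDist_root, upDist_of_eq hy (hcxy.1 (by rw [hx]))] at h
    omega
  · have := beta_bounds hD hβ v hx
    rw [hy, upDist_root, upDist_of_eq hx (hcxy.2 (by rw [hy]))] at h
    omega
  · have hbx := beta_bounds hD hβ v hx
    have hby := beta_bounds hD hβ v hy
    refine (hβ v).injOn hx hy ?_
    by_cases hc : c x = c ρ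
    · rwa [upDist_of_eq hx hc, upDist_of_eq hy (hcxy.1 hc)] at h
    · rw [upDist_of_ne hx hc, upDist_of_ne hy (fun h => hc (hcxy.2 h))] at h
      omega

theorem attachCopies_isBipartite (hm : 0 < m) (hD : IsOddAugmentation d r m D)
    (hβ : ∀ v, Set.BijOn (β v) {x | x ≠ ρ} (D v.1 : Set ℕ))
    (hc : ∀ x y, G.Adj x y → c x ≠ c y) : (attachCopies G ρ d m c β).IsBipartite := by
  classical
  let F : ReducedInner d m ⊕ ReducedLeaf d m × V → Prop
    | Sum.inl w => Even w.1.length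
    -- The leaf itself, `x = ρ`, has the parity of its level `m`; the copy alternates from there.
    | Sum.inr (_, x) => (Even m ↔ c x = c ρ)
  refine ⟨SimpleGraph.Coloring.mk (fun p => if F p then 0 else 1) fun {p q} hpq => ?_⟩
  have : ¬ (F p ↔ F q) := by
    refine attachCopies_adj_rec (P := fun p q => ¬ (F p ↔ F q)) (fun p q h => by tauto)
      (fun u w i h => ?_) (fun v x w h => ?_) (fun v x y h => ?_) hpq
    · simp only [F, h, List.length_cons, Nat.even_add_one]; tauto
    · obtain ⟨-, h₁, h₂⟩ := upDist_bounds (c := c) hm hD hβ v x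
      simp only [F, h, List.length_drop, v.2.1]
      rw [Nat.even_sub h₁, ← h₂, ← Nat.not_even_iff_odd]
      tauto
    · have := hc x y h
      have : ¬ (c x = c ρ ↔ c y = c ρ) := by
        revert this
        cases c x <;> cases c y <;> cases c ρ <;> simp
      simp only [F]
      tauto
  by_cases h₁ : F p <;> by_cases h₂ : F q <;> simp_all

/-- The word of the vertex of the tree to which a vertex belongs. -/
def wordMap : ReducedInner d m ⊕ ReducedLeaf d m × V → {w : List (Fin d) // w.length ≤ m}
  | Sum.inl w => ⟨w.1, w.2.1.le⟩
  | Sum.inr (v, _) => ⟨v.1, v.2.1.le⟩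

open Classical in
/-- The retraction to the copy at the leaf `v`. -/
noncomputable def copyMap (ρ : V) (v : ReducedLeaf d m) :
    ReducedInner d m ⊕ ReducedLeaf d m × V → V
  | Sum.inl _ => ρ
  | Sum.inr (v', x) => if v' = v then x else ρ

/-- Copies contract to their leaves. An inherited edge becomes its original augmenting edge followed
by at most one tree step, since its upper end may have been shifted. -/
theorem attachCopies_egirth_up {g : ℕ} (hm : 0 < m) (hD : IsOddAugmentation d r m D)
    (hβ : ∀ v, Set.BijOn (β v) {x | x ≠ ρ} (D v.1 : Set ℕ))
    (hg : ((2 * g : ℕ) : ℕ∞) ≤ (augmentedTree d m D).egirth)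
    {z : ReducedInner d m ⊕ ReducedLeaf d m × V} {p : (attachCopies G ρ d m c β).Walk z z}
    (hp : p.IsCycle) {v : ReducedLeaf d m} {x : V} {w : ReducedInner d m}
    (hw : w.1 = v.1.drop (upDist ρ c β v x)) (hx : x ≠ ρ)
    (hmem : s(Sum.inr (v, x), Sum.inl w) ∈ p.edges) : g ≤ p.length := by
  obtain ⟨q, hq, hqe, -⟩ := hp.exists_walk_of_mem_edges hmem
  obtain ⟨hb, hb3, hbm, hbo⟩ := beta_bounds hD hβ v hx
  have hdl : ∀ (v : ReducedLeaf d m) i, (v.1.drop i).length ≤ m := fun v i => by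
    simp [v.2.1]
  set e : Sym2 {w : List (Fin d) // w.length ≤ m} :=
    s(⟨v.1, v.2.1.le⟩, ⟨v.1.drop (β v x), hdl _ _⟩) with he
  have tree : ∀ (u t : {w : List (Fin d) // w.length ≤ m}) (i : Fin d), u.1 = i :: t.1 →
      (augmentedTree d m D).JoinedAvoiding e 1 u t := by
    rintro ⟨u, hu⟩ ⟨t, ht⟩ i rfl
    refine .of_adj (augmentedTree_adj_cons _ _) (sym2_words_ne ?_)
    simp only [List.length_cons, List.length_drop, v.2.1]
    omega
  have shift : ∀ (v' : ReducedLeaf d m) (i : ℕ) (_ : 1 ≤ i) (_ : i ≤ m)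
      (t t' : {w : List (Fin d) // w.length ≤ m}), t.1 = v'.1.drop (i - 1) → t'.1 = v'.1.drop i →
      (augmentedTree d m D).JoinedAvoiding e 1 t t' := by
    intro v' i h1 hi t t' ht ht'
    refine tree _ _ (v'.1[i - 1]'(by rw [v'.2.1]; omega)) ?_
    rw [ht, ht', List.drop_eq_getElem_cons (by rw [v'.2.1]; omega)]
    congr 2; omega
  have upper : ∀ (v' : ReducedLeaf d m) (y : V) (t : ReducedInner d m) (_ : y ≠ ρ),
      t.1 = v'.1.drop (upDist ρ c β v' y) →
      (augmentedTree d m D).JoinedAvoiding e 1 (⟨v'.1.drop (β v' y), hdl _ _⟩)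
        ⟨t.1, t.2.1.le⟩ := by
    intro v' y t hy ht
    obtain ⟨-, hb3', hbm', -⟩ := beta_bounds hD hβ v' hy
    by_cases hc : c y = c ρ
    · rw [upDist_of_eq hy hc] at ht
      exact .of_eq (Subtype.ext ht.symm)
    · rw [upDist_of_ne hy hc] at ht
      exact (shift v' (β v' y) (by omega) hbm' _ _ ht rfl).symm
  have joined : ∀ a b, (attachCopies G ρ d m c β).Adj a b → s(a, b) ∈ q.edges →
      (augmentedTree d m D).JoinedAvoiding e 2 (wordMap a) (wordMap b) := by
    intro a b hab
    refine attachCopies_adj_rec (P := fun a b => s(a, b) ∈ q.edges →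
      (augmentedTree d m D).JoinedAvoiding e 2 (wordMap a) (wordMap b))
      (fun a b h => ?_) (fun u t i h _ => ?_) (fun v' y t h hmem' => ?_)
      (fun v' y y' h _ => .of_eq rfl) hab
    · rw [Sym2.eq_swap]; exact fun hmem => (h hmem).symm
    · exact (tree (wordMap (Sum.inl u)) (wordMap (Sum.inl t)) i h).mono (by omega)
    · by_cases hy : y = ρ
      · subst hy
        rw [upDist_root] at h
        exact (shift v' 1 le_rfl (by omega) (wordMap (Sum.inr (v', y))) (wordMap (Sum.inl t)) rfl
          h).mono (by omega)
      · obtain ⟨hb', hb3', hbm', -⟩ := beta_bounds hD hβ v' hy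
        have hu := upper v' y t hy h
        refine SimpleGraph.JoinedAvoiding.trans (n := 1) (m := 1) (.of_adj
          (augmentedTree_adj_drop v'.2.1 hb' (by omega) hbm' _ (hdl _ _)) fun heq => hqe ?_) hu
        obtain ⟨h₁, h₂⟩ := sym2_drop_inj v'.2.1 v.2.1 (by omega) (by omega) heq
        obtain rfl : v' = v := Subtype.ext h₁
        obtain rfl : y = x := (hβ v').injOn hy hx h₂
        obtain rfl : t = w := Subtype.ext (h.trans hw.symm)
        exact hmem'
  -- The closed walk has length at most `1 + 1 + 2 (|p| - 1) = 2 |p|`, to be compared with `2 * g`.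
  have h₁ := (upper v x w hx hw).trans (q.joinedAvoiding_map wordMap e 2 joined)
  have h₂ := hg.trans (h₁.egirth_le
    (augmentedTree_adj_drop v.2.1 hb (by omega) hbm v.2.1.le (hdl _ _)))
  norm_cast at h₂
  omega

/-- If the cycle meets the tree only through roots of copies, sending everything outside the copy at
`v` to `ρ` collapses all edges outside that copy. -/
theorem attachCopies_egirth_copy {g : ℕ} (hg : (g : ℕ∞) ≤ G.egirth)
    {z : ReducedInner d m ⊕ ReducedLeaf d m × V} {p : (attachCopies G ρ d m c β).Walk z z}
    (hp : p.IsCycle) {v : ReducedLeaf d m} {x y : V} (hxy : G.Adj x y)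
    (hmem : s(Sum.inr (v, x), Sum.inr (v, y)) ∈ p.edges)
    (hup : ∀ (v : ReducedLeaf d m) (x : V) (w : ReducedInner d m),
      s(Sum.inr (v, x), Sum.inl w) ∈ p.edges → x = ρ) : g ≤ p.length := by
  obtain ⟨q, hq, hqe, hqp⟩ := hp.exists_walk_of_mem_edges hmem
  have joined : ∀ a b, (attachCopies G ρ d m c β).Adj a b → s(a, b) ∈ q.edges →
      G.JoinedAvoiding s(x, y) 1 (copyMap ρ v a) (copyMap ρ v b) := by
    intro a b hab
    refine attachCopies_adj_rec (P := fun a b => s(a, b) ∈ q.edges →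
      G.JoinedAvoiding s(x, y) 1 (copyMap ρ v a) (copyMap ρ v b))
      (fun a b h => ?_) (fun u t i h _ => .of_eq rfl) (fun v' t w h hmem' => .of_eq ?_)
      (fun v' t t' h hmem' => ?_) hab
    · rw [Sym2.eq_swap]; exact fun hmem => (h hmem).symm
    · simp [copyMap, hup v' t w (hqp hmem')]
    · by_cases hv : v' = v
      · subst hv
        simp only [copyMap, if_true]
        refine .of_adj h fun heq => hqe ?_
        rcases Sym2.eq_iff.1 heq with ⟨rfl, rfl⟩ | ⟨rfl, rfl⟩
        · exact hmem'
        · rwa [Sym2.eq_swap]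
      · exact .of_eq (by simp [copyMap, hv])
  have h₁ := q.joinedAvoiding_map (copyMap ρ v) _ 1 joined
  simp only [copyMap, if_true] at h₁
  have h₂ := hg.trans (h₁.egirth_le hxy)
  norm_cast at h₂
  omega

theorem attachCopies_egirth {g : ℕ} (hm : 0 < m) (hD : IsOddAugmentation d r m D)
    (hβ : ∀ v, Set.BijOn (β v) {x | x ≠ ρ} (D v.1 : Set ℕ))
    (hg : (g : ℕ∞) ≤ G.egirth) (hg' : ((2 * g : ℕ) : ℕ∞) ≤ (augmentedTree d m D).egirth) :
    (g : ℕ∞) ≤ (attachCopies G ρ d m c β).egirth := by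
  rw [SimpleGraph.le_egirth]
  intro z p hp
  rw [Nat.cast_le]
  by_cases hup : ∃ (v : ReducedLeaf d m) (x : V) (w : ReducedInner d m),
      x ≠ ρ ∧ s(Sum.inr (v, x), Sum.inl w) ∈ p.edges
  · obtain ⟨v, x, w, hx, hmem⟩ := hup
    have hw := p.adj_of_mem_edges hmem
    refine attachCopies_egirth_up hm hD hβ hg' hp ?_ hx hmem
    rcases ((SimpleGraph.fromRel_adj _ _ _).1 hw).2 with h | h
    · exact h
    · exact h.elim
  have hup' : ∀ (v : ReducedLeaf d m) (x : V) (w : ReducedInner d m),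
      s(Sum.inr (v, x), Sum.inl w) ∈ p.edges → x = ρ := fun v x w h => by
    by_contra hx
    exact hup ⟨v, x, w, hx, h⟩
  by_cases hcopy : ∃ (v : ReducedLeaf d m) (x y : V),
      G.Adj x y ∧ s(Sum.inr (v, x), Sum.inr (v, y)) ∈ p.edges
  · obtain ⟨v, x, y, hxy, hmem⟩ := hcopy
    exact attachCopies_egirth_copy hg hp hxy hmem hup'
  -- Only edges of the reduced tree are left, and these contain no cycle.
  exfalso
  have tree : ∀ a b, (attachCopies G ρ d m c β).Adj a b → s(a, b) ∈ p.edges →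
      ∃ (i : Fin d) (w : ReducedInner d m) (a' : ReducedInner d m ⊕ ReducedLeaf d m × V),
        s(a, b) = s(a', Sum.inl w) ∧ (wordMap a').1 = i :: w.1 ∧
          ∀ v x, a' = Sum.inr (v, x) → x = ρ := by
    intro a b hab
    refine attachCopies_adj_rec (P := fun a b => s(a, b) ∈ p.edges →
      ∃ (i : Fin d) (w : ReducedInner d m) (a' : ReducedInner d m ⊕ ReducedLeaf d m × V),
        s(a, b) = s(a', Sum.inl w) ∧ (wordMap a').1 = i :: w.1 ∧
          ∀ v x, a' = Sum.inr (v, x) → x = ρ)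
      (fun a b h => ?_) (fun u t i h _ => ⟨i, t, Sum.inl u, rfl, h, by simp⟩)
      (fun v x w h hmem => ?_) (fun v x y h hmem => absurd ⟨v, x, y, h, hmem⟩ hcopy) hab
    · rw [Sym2.eq_swap]; exact h
    · obtain rfl := hup' v x w hmem
      rw [upDist_root] at h
      have hv : v.1 = v.1[0]'(by rw [v.2.1]; exact hm) :: v.1.drop 1 := by
        rw [← List.drop_eq_getElem_cons, List.drop_zero]
      refine ⟨v.1[0]'(by rw [v.2.1]; exact hm), w, Sum.inr (v, x), rfl, ?_, ?_⟩
      · rw [h]; exact hv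
      · rintro v' x' h
        exact (Prod.mk.inj (Sum.inr.inj h)).2.symm
  obtain ⟨e, he⟩ : ∃ e, e ∈ p.edges := by
    apply List.exists_mem_of_ne_nil
    intro h
    have h₁ := congrArg List.length h
    rw [SimpleGraph.Walk.length_edges, List.length_nil] at h₁
    have := hp.three_le_length
    omega
  induction e using Sym2.ind with
  | _ a b =>
  obtain ⟨i, w, a', hab, ha, ha'⟩ := tree a b (p.adj_of_mem_edges he) he
  rw [hab] at he
  obtain ⟨q, -, hq, hqp⟩ := hp.exists_walk_of_mem_edges he
  have := q.iff_of_forall_edges (fun t => (i :: w.1) <:+ (wordMap t).1) fun t t' htt hmem => by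
    obtain ⟨i', w', b', he', hb, hb'⟩ := tree t t' htt (hqp hmem)
    have hne : i :: w.1 ≠ i' :: w'.1 := by
      rintro hh
      refine hq ?_
      have hww : w = w' := Subtype.ext (List.cons.inj hh).2
      have hword : (wordMap a').1 = (wordMap b').1 := by rw [ha, hb, hh]
      have : a' = b' := by
        rcases a' with u | ⟨v, x⟩ <;> rcases b' with u' | ⟨v', x'⟩
        · exact congrArg Sum.inl (Subtype.ext hword)
        · exact absurd (congrArg List.length hword) (by
            have := u.2.1; have := v'.2.1; simp only [wordMap]; omega)
        · exact absurd (congrArg List.length hword) (by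
            have := u'.2.1; have := v.2.1; simp only [wordMap]; omega)
        · obtain rfl := ha' v x rfl
          obtain rfl := hb' v' x' rfl
          rw [show v = v' from Subtype.ext hword]
      have heq : s(a', Sum.inl w) = s(t, t') := by rw [he', this, hww]
      exact heq ▸ hmem
    have : (i :: w.1) <:+ (i' :: w'.1) ↔ (i :: w.1) <:+ w'.1 := by
      rw [List.suffix_cons_iff]
      exact or_iff_right hne
    rcases Sym2.eq_iff.1 he' with ⟨rfl, rfl⟩ | ⟨rfl, rfl⟩
    · rw [hb]; exact this
    · rw [hb]; exact this.symm
  have h3 := (this.2 (by rw [ha])).length_le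
  simp [wordMap] at h3

end

end AttachCopies

/-! ### Separated lists without a colouring -/

/-- `G` has lists of `k` colours, sharing exactly one colour along every edge, from which it cannot
be properly coloured. -/
def HasSeparatedBadLists {V : Type} (G : SimpleGraph V) (k : ℕ) : Prop :=
  ∃ (K : Type) (_ : Countable K) (_ : DecidableEq K) (L : V → Finset K),
    (∀ v, (L v).card = k) ∧ (∀ u v, G.Adj u v → (L u ∩ L v).card = 1) ∧
      ¬ ∃ f : V → K, (∀ u v, G.Adj u v → f u ≠ f v) ∧ ∀ v, f v ∈ L v

theorem HasSeparatedBadLists.exists_lists {V : Type} {G : SimpleGraph V} {k : ℕ}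
    (h : HasSeparatedBadLists G k) : ∃ L : V → Finset ℕ, (∀ v, (L v).card = k) ∧
      (∀ u v, G.Adj u v → (L u ∩ L v).card = 1) ∧ ¬ IsListColorable G L := by
  obtain ⟨K, _, _, L, h₁, h₂, h₃⟩ := h
  obtain ⟨φ, hφ⟩ := Countable.exists_injective_nat K
  refine ⟨fun v => (L v).map ⟨φ, hφ⟩, fun v => by simp [h₁], fun u v huv => ?_, ?_⟩
  · rw [← Finset.map_inter, Finset.card_map, h₂ u v huv]
  · rintro ⟨f, hf⟩
    simp only [Finset.mem_map, Function.Embedding.coeFn_mk] at hf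
    choose f' hf' hff' using hf
    refine h₃ ⟨f', fun u v huv h => f.valid huv ?_, hf'⟩
    rw [← hff' u, ← hff' v, h]

section Lists

variable {d : ℕ}

/-- The colours available at the vertex `w` of the reduced tree are the edges at `w`, named after
their lower ends. -/
def treeColor (w : List (Fin d)) (i : Fin d) : List (Fin d) :=
  if (i :: w).IsChain (· ≠ ·) then i :: w else w

theorem treeColor_cons {w : List (Fin d)} {i : Fin d} (h : (i :: w).IsChain (· ≠ ·)) :
    treeColor w i = i :: w := if_pos h

theorem isChain_ne_cons_of_ne {w : List (Fin d)} (hw : w.IsChain (· ≠ ·)) {i j : Fin d}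
    (hi : ¬ (i :: w).IsChain (· ≠ ·)) (hij : i ≠ j) : (j :: w).IsChain (· ≠ ·) := by
  cases w with
  | nil => simp
  | cons a w =>
    rw [List.isChain_cons_cons] at hi ⊢
    refine ⟨?_, hw⟩
    rintro rfl
    exact hi ⟨hij, hw⟩

/-- At a non-root vertex exactly one letter, the repeated one, yields the edge to the parent; all
others yield distinct descending edges. -/
theorem treeColor_injective {w : List (Fin d)} (hw : w.IsChain (· ≠ ·)) :
    Function.Injective (treeColor w) := by
  intro i j h
  by_contra hij
  rw [treeColor, treeColor] at h
  split_ifs at h with hi hj hj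
  · exact hij (List.cons.inj h).1
  · simpa using congrArg List.length h
  · simpa using congrArg List.length h
  · exact hj (isChain_ne_cons_of_ne hw hi hij)

theorem length_treeColor (w : List (Fin d)) (i : Fin d) :
    (treeColor w i).length = w.length + 1 ∨ treeColor w i = w := by
  rw [treeColor]
  split_ifs <;> simp

variable {V K : Type} {G : SimpleGraph V} {ρ : V} {m r : ℕ} {c : V → Bool}
  {β : ReducedLeaf d m → V → ℕ} {D : List (Fin d) → Finset ℕ} [DecidableEq K]

/-- The lists of colours of `attachCopies`, given lists for the attached graph. -/
noncomputable def attachLists (ρ : V) (c : V → Bool) (β : ReducedLeaf d m → V → ℕ)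
    (L : V → Finset K) :
    ReducedInner d m ⊕ ReducedLeaf d m × V → Finset (List (Fin d) ⊕ ReducedLeaf d m × K)
  | Sum.inl w => Finset.univ.image fun i => Sum.inl (treeColor w.1 i)
  | Sum.inr (v, x) => insert (Sum.inl (v.1.drop (upDist ρ c β v x - 1)))
      ((L x).image fun κ => Sum.inr (v, κ))

theorem card_attachLists {k : ℕ} {L : V → Finset K} (hL : ∀ v, (L v).card = k)
    (p : ReducedInner (k + 1) m ⊕ ReducedLeaf (k + 1) m × V) (β : ReducedLeaf (k + 1) m → V → ℕ) :
    (attachLists ρ c β L p).card = k + 1 := by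
  rcases p with w | ⟨v, x⟩
  · rw [attachLists, Finset.card_image_of_injective, Finset.card_fin]
    exact Sum.inl_injective.comp (treeColor_injective w.2.2)
  · rw [attachLists, Finset.card_insert_of_notMem (by simp), Finset.card_image_of_injective, hL]
    intro a b h
    exact (Prod.mk.inj (Sum.inr.inj h)).2

theorem drop_pred_eq_cons {v : ReducedLeaf d m} {j : ℕ} (h1 : 1 ≤ j) (hj : j ≤ m) :
    ∃ i, v.1.drop (j - 1) = i :: v.1.drop j := by
  refine ⟨v.1[j - 1]'(by rw [v.2.1]; omega), ?_⟩
  rw [List.drop_eq_getElem_cons (by rw [v.2.1]; omega)]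
  congr 2; omega

/-- Parent and child share the edge between them. A copy vertex and its tree neighbour share the
path edge below that neighbour. Inside a copy the path edges differ, so only the old common colour
remains. -/
theorem card_attachLists_inter {L : V → Finset K} (hm : 0 < m) (hD : IsOddAugmentation d r m D)
    (hβ : ∀ v, Set.BijOn (β v) {x | x ≠ ρ} (D v.1 : Set ℕ))
    (hL : ∀ u v, G.Adj u v → (L u ∩ L v).card = 1)
    {p q : ReducedInner d m ⊕ ReducedLeaf d m × V} (h : (attachCopies G ρ d m c β).Adj p q) :
    (attachLists ρ c β L p ∩ attachLists ρ c β L q).card = 1 := by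
  refine attachCopies_adj_rec
    (P := fun p q => (attachLists ρ c β L p ∩ attachLists ρ c β L q).card = 1)
    (fun p q h => by rwa [Finset.inter_comm]) (fun u w i h => ?_) (fun v x w h => ?_)
    (fun v x y h => ?_) h
  · rw [Finset.card_eq_one]
    refine ⟨Sum.inl u.1, Finset.eq_singleton_iff_unique_mem.2 ⟨?_, ?_⟩⟩
    · simp only [attachLists, Finset.mem_inter, Finset.mem_image, Finset.mem_univ, true_and]
      refine ⟨⟨i, congrArg Sum.inl ?_⟩, i, congrArg Sum.inl ?_⟩
      · rw [treeColor, if_neg]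
        rw [h, List.isChain_cons_cons]
        exact fun h' => h'.1 rfl
      · rw [treeColor_cons (h ▸ u.2.2), h]
    · intro t ht
      simp only [attachLists, Finset.mem_inter, Finset.mem_image, Finset.mem_univ, true_and] at ht
      obtain ⟨⟨a, rfl⟩, b, hb⟩ := ht
      have hb := Sum.inl.inj hb
      refine congrArg Sum.inl ((length_treeColor u.1 a).resolve_left fun ha => ?_)
      have hu := congrArg List.length h
      rw [List.length_cons] at hu
      rw [← hb] at ha
      rcases length_treeColor w.1 b with h' | h'
      · omega
      · rw [h'] at ha; omega
  · obtain ⟨h1, hjm, -⟩ := upDist_bounds (c := c) hm hD hβ v x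
    obtain ⟨i, hi⟩ := drop_pred_eq_cons (v := v) h1 hjm
    rw [Finset.card_eq_one]
    refine ⟨Sum.inl (v.1.drop (upDist ρ c β v x - 1)),
      Finset.eq_singleton_iff_unique_mem.2 ⟨?_, ?_⟩⟩
    · simp only [attachLists, Finset.mem_inter, Finset.mem_image, Finset.mem_univ, true_and]
      refine ⟨Finset.mem_insert_self _ _, i, congrArg Sum.inl ?_⟩
      rw [treeColor_cons, hi, h]
      rw [h, ← hi]
      exact v.2.2.drop _
    · intro t ht
      simp only [attachLists, Finset.mem_inter, Finset.mem_insert, Finset.mem_image,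
        Finset.mem_univ, true_and] at ht
      obtain ⟨rfl | ⟨κ, -, rfl⟩, b, hb⟩ := ht
      · rfl
      · cases hb
  · have hne : upDist ρ c β v x - 1 ≠ upDist ρ c β v y - 1 := fun h' => h.ne
      (upDist_injective (c := c) hm hD hβ v (by
        have := upDist_bounds (c := c) hm hD hβ v x
        have := upDist_bounds (c := c) hm hD hβ v y
        omega))
    have hne' : v.1.drop (upDist ρ c β v x - 1) ≠ v.1.drop (upDist ρ c β v y - 1) := fun h' => hne (by
        have := upDist_bounds (c := c) hm hD hβ v x
        have := upDist_bounds (c := c) hm hD hβ v y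
        have := congrArg List.length h'
        simp only [List.length_drop, v.2.1] at this
        omega)
    have hinj : Function.Injective fun κ : K =>
        (Sum.inr (v, κ) : List (Fin d) ⊕ ReducedLeaf d m × K) :=
      fun a b h => (Prod.mk.inj (Sum.inr.inj h)).2
    simp only [attachLists]
    rw [Finset.insert_inter_of_notMem (by simp [hne']), Finset.inter_insert_of_notMem (by simp),
      ← Finset.image_inter _ _ hinj, Finset.card_image_of_injective _ hinj, hL x y h]

theorem HasSeparatedBadLists.attachCopies {k : ℕ} {D : List (Fin (k + 1)) → Finset ℕ}
    {β : ReducedLeaf (k + 1) m → V → ℕ} (hG : HasSeparatedBadLists G k) (hm : 0 < m)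
    (hD : IsOddAugmentation (k + 1) r m D)
    (hβ : ∀ v, Set.BijOn (β v) {x | x ≠ ρ} (D v.1 : Set ℕ)) :
    HasSeparatedBadLists (attachCopies G ρ (k + 1) m c β) (k + 1) := by
  obtain ⟨K, _, _, L, h₁, h₂, h₃⟩ := hG
  refine ⟨_, inferInstance, inferInstance, attachLists ρ c β L, fun p => card_attachLists h₁ p β,
    fun p q hpq => card_attachLists_inter hm hD hβ h₂ hpq, ?_⟩
  rintro ⟨f, hf, hfL⟩
  -- Follow the chosen edges down from the root: every proper ancestor of `w` has chosen the edge
  -- towards `w`.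
  have path : ∀ n ≤ m, ∃ w : List (Fin (k + 1)), w.length = n ∧ w.IsChain (· ≠ ·) ∧
      ∀ (j : ℕ) (u : ReducedInner (k + 1) m), j < n → u.1 = w.drop (j + 1) →
        f (Sum.inl u) = Sum.inl (w.drop j) := by
    intro n
    induction n with
    | zero => exact fun _ => ⟨[], rfl, by simp, by simp⟩
    | succ n ih =>
      intro hn
      obtain ⟨w, hwn, hw, hwf⟩ := ih (by omega)
      have hcol := hfL (Sum.inl ⟨w, by omega, hw⟩)
      simp only [attachLists, Finset.mem_image, Finset.mem_univ, true_and] at hcol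
      obtain ⟨i, hi⟩ := hcol
      by_cases hiw : (i :: w).IsChain (· ≠ ·)
      · rw [treeColor_cons hiw] at hi
        refine ⟨i :: w, by simp [hwn], hiw, fun j u hj hu => ?_⟩
        cases j with
        | zero =>
          rw [show u = ⟨w, by omega, hw⟩ from Subtype.ext hu]
          exact hi.symm
        | succ j => exact hwf j u (by omega) hu
      -- The only other choice at a non-root vertex is the edge to its parent, which the parent has
      -- already taken.
      · exfalso
        rw [treeColor, if_neg hiw] at hi
        cases w with
        | nil => simp at hiw
        | cons a w =>
          rw [List.length_cons] at hwn
          have hpar := hwf 0 ⟨w, by omega, hw.tail⟩ (by omega) rfl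
          exact hf _ _ (attachCopies_adj_tree ⟨a :: w, by simp; omega, hw⟩ ⟨w, by omega, hw.tail⟩
            rfl) (by rw [← hi, hpar]; rfl)
  obtain ⟨w, hwm, hw, hwf⟩ := path m le_rfl
  let v : ReducedLeaf (k + 1) m := ⟨w, hwm, hw⟩
  have hcopy : ∀ x, ∃ κ ∈ L x, Sum.inr (v, κ) = f (Sum.inr (v, x)) := by
    intro x
    have hx := hfL (Sum.inr (v, x))
    rw [attachLists, Finset.mem_insert, Finset.mem_image] at hx
    refine hx.resolve_left fun hx => ?_
    obtain ⟨h1, hjm, -⟩ := upDist_bounds (c := c) hm hD hβ v x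
    let u : ReducedInner (k + 1) m :=
      ⟨v.1.drop (upDist ρ c β v x), by rw [List.length_drop, v.2.1]; omega, v.2.2.drop _⟩
    refine hf _ _ (attachCopies_adj_up v x u rfl) ?_
    rw [hx]
    refine (hwf _ u (by omega) ?_).symm
    rw [Nat.sub_add_cancel h1]
  choose f' hf' hff' using hcopy
  refine h₃ ⟨f', fun x y hxy h => hf _ _ (attachCopies_adj_copy v hxy) ?_, hf'⟩
  rw [← hff' x, ← hff' y, h]

end Lists

/-! ### Edge density of subgraphs -/

/-- Every subgraph `H` of `G` has at most `n |V(H)| + 1` edges, and at most `n |V(H)|` if it is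
proper. -/
def IsNearlySparse {V : Type} (G : SimpleGraph V) (n : ℕ) : Prop :=
  ∀ H : G.Subgraph, H.edgeSet.ncard ≤ n * H.verts.ncard + 1 ∧
    (H.edgeSet.ncard = n * H.verts.ncard + 1 → H = ⊤)

theorem IsNearlySparse.avgDegree_le {V : Type} {G : SimpleGraph V} {n : ℕ}
    (hG : IsNearlySparse G n) {H : G.Subgraph} (hH : H ≠ ⊤) : avgDegree H ≤ 2 * n := by
  have hle : H.edgeSet.ncard ≤ n * H.verts.ncard :=
    Nat.lt_succ_iff.1 (lt_of_le_of_ne (hG H).1 fun h => hH ((hG H).2 h))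
  rw [avgDegree]
  refine div_le_of_le_mul₀ (by positivity) (by positivity) ?_
  have : (H.edgeSet.ncard : ℚ) ≤ n * H.verts.ncard := by exact_mod_cast hle
  linarith

/-! ### The base graph: two cycles through a common vertex -/

section TwoCycles

variable {g : ℕ}

/-- The vertex preceding a vertex on its cycle. -/
def predVertex (x : Bool × Fin (g - 1)) : Option (Bool × Fin (g - 1)) :=
  if x.2.val = 0 then none else some (x.1, ⟨x.2.val - 1, by omega⟩)

/-- The position of a vertex on the cycle with index `b`; the vertices of the other cycle have
position `0`. -/
def cyclePos (b : Bool) : Option (Bool × Fin (g - 1)) → ℕ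
  | none => 0
  | some x => if x.1 = b then x.2.val + 1 else 0

theorem cyclePos_predVertex (b : Bool) (x : Bool × Fin (g - 1)) :
    cyclePos b (predVertex x) = if x.1 = b then x.2.val else 0 := by
  rw [predVertex]
  split_ifs <;> simp_all [cyclePos]
  omega

theorem twoCycles_adj_predVertex (x : Bool × Fin (g - 1)) :
    (twoCycles g).Adj (some x) (predVertex x) := by
  obtain ⟨b, i⟩ := x
  rw [predVertex]
  split_ifs with h
  · exact (SimpleGraph.fromRel_adj _ _ _).2 ⟨by simp, .inr (.inl h)⟩
  · refine (SimpleGraph.fromRel_adj _ _ _).2 ⟨?_, .inr ⟨rfl, ?_⟩⟩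
    · intro h'
      have := congrArg (fun x => x.2.val) (Option.some.inj h')
      simp only at this h
      omega
    · simp only at h ⊢; omega

theorem twoCycles_adj_last (b : Bool) (i : Fin (g - 1)) (h : i.val + 1 = g - 1) :
    (twoCycles g).Adj (some (b, i)) none :=
  (SimpleGraph.fromRel_adj _ _ _).2 ⟨by simp, .inr (.inr h)⟩

/-- Induction over the edges of `twoCycles`, for a symmetric property. -/
theorem twoCycles_adj_rec {P : Option (Bool × Fin (g - 1)) → Option (Bool × Fin (g - 1)) → Prop}
    (hP : ∀ p q, P p q → P q p) (pred : ∀ x, P (some x) (predVertex x))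
    (last : ∀ (b : Bool) (i : Fin (g - 1)), i.val + 1 = g - 1 → P (some (b, i)) none)
    {p q : Option (Bool × Fin (g - 1))} (h : (twoCycles g).Adj p q) : P p q := by
  have hroot : ∀ (b : Bool) (i : Fin (g - 1)), (i.val = 0 ∨ i.val + 1 = g - 1) →
      P (some (b, i)) none := by
    rintro b i (hi | hi)
    · have := pred (b, i)
      rwa [predVertex, if_pos hi] at this
    · exact last b i hi
  have hstep : ∀ (b b' : Bool) (i j : Fin (g - 1)), b = b' ∧ i.val + 1 = j.val →
      P (some (b', j)) (some (b, i)) := by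
    rintro b _ i j ⟨rfl, hij⟩
    have := pred (b, j)
    rw [predVertex, if_neg (by simp; omega)] at this
    convert this using 4
    simp; omega
  have h' := ((SimpleGraph.fromRel_adj _ _ _).1 h).2
  rcases p with _ | ⟨b, i⟩ <;> rcases q with _ | ⟨b', j⟩
  · rcases h' with h' | h' <;> exact h'.elim
  · rcases h' with h' | h'
    · exact hP _ _ (hroot b' j h')
    · exact h'.elim
  · rcases h' with h' | h'
    · exact h'.elim
    · exact hroot b i h'
  · rcases h' with h' | h'
    · exact hP _ _ (hstep b b' i j h')
    · exact hstep b' b j i h'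

theorem twoCycles_isBipartite (hg : Even g) : (twoCycles g).IsBipartite := by
  classical
  let F : Option (Bool × Fin (g - 1)) → Prop
    | none => False
    | some x => Even x.2.val
  refine ⟨SimpleGraph.Coloring.mk (fun p => if F p then 0 else 1) fun {p q} hpq => ?_⟩
  have : ¬ (F p ↔ F q) := by
    refine twoCycles_adj_rec (P := fun p q => ¬ (F p ↔ F q)) (fun p q h => by tauto)
      (fun x => ?_) (fun b i h => ?_) hpq
    · rw [predVertex]
      split_ifs with h
      · simp [F, h]
      · simp only [F]
        rw [Nat.even_sub (by omega)]
        simp only [Nat.not_even_one, iff_false]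
        tauto
    · simp only [F, iff_false, not_not]
      obtain ⟨t, ht⟩ := hg
      exact ⟨t - 1, by omega⟩
  by_cases h₁ : F p <;> by_cases h₂ : F q <;> simp_all

theorem SimpleGraph.Walk.le_add_length_of_forall_edges {V : Type} {G : SimpleGraph V} (φ : V → ℕ)
    {x y : V} (p : G.Walk x y)
    (h : ∀ u v, G.Adj u v → s(u, v) ∈ p.edges → φ v ≤ φ u + 1) : φ y ≤ φ x + p.length := by
  induction p with
  | nil => simp
  | cons hadj p ih =>
    have h₁ := h _ _ hadj (by simp)
    have h₂ := ih fun u v huv he => h u v huv (by simp [he])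
    rw [Walk.length_cons]
    omega

/-- Off the closing edge of a cycle, the position changes by at most `1` per step, while that edge
joins positions `g - 1` and `0`. Without closing edges the graph is a tree. -/
theorem twoCycles_egirth : (g : ℕ∞) ≤ (twoCycles g).egirth := by
  rw [SimpleGraph.le_egirth]
  intro z p hp
  rw [Nat.cast_le]
  by_cases hlast : ∃ (b : Bool) (i : Fin (g - 1)), i.val + 1 = g - 1 ∧
      s(some (b, i), none) ∈ p.edges
  · obtain ⟨b, i, hi, hmem⟩ := hlast
    obtain ⟨q, hq, hqe, -⟩ := hp.exists_walk_of_mem_edges hmem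
    have := q.le_add_length_of_forall_edges (cyclePos b) fun u v huv hmem' => by
      refine (twoCycles_adj_rec (P := fun u v => s(u, v) ∈ q.edges →
        cyclePos b u ≤ cyclePos b v + 1 ∧ cyclePos b v ≤ cyclePos b u + 1)
        (fun u v h => ?_) (fun x _ => ?_) (fun b' j hj hmem' => ?_) huv hmem').2
      · rw [Sym2.eq_swap]; exact fun h' => (h h').symm
      · rw [cyclePos_predVertex, cyclePos]
        split_ifs <;> omega
      · have hb : b' ≠ b := by
          rintro rfl
          obtain rfl : i = j := Fin.ext (by omega)
          exact hqe hmem'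
        simp [cyclePos, hb]
    simp [cyclePos] at this
    omega
  exfalso
  have tree : ∀ u v, (twoCycles g).Adj u v → s(u, v) ∈ p.edges →
      ∃ x, s(u, v) = s(some x, predVertex x) := by
    intro u v huv
    refine twoCycles_adj_rec (P := fun u v => s(u, v) ∈ p.edges →
      ∃ x, s(u, v) = s(some x, predVertex x)) (fun u v h => ?_) (fun x _ => ⟨x, rfl⟩)
      (fun b i h hmem => absurd ⟨b, i, h, hmem⟩ hlast) huv
    rw [Sym2.eq_swap]; exact h
  obtain ⟨e, he⟩ : ∃ e, e ∈ p.edges := by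
    apply List.exists_mem_of_ne_nil
    intro h
    have h₁ := congrArg List.length h
    rw [SimpleGraph.Walk.length_edges, List.length_nil] at h₁
    have := hp.three_le_length
    omega
  induction e using Sym2.ind with
  | _ a b =>
  obtain ⟨⟨b, i⟩, hx⟩ := tree a b (p.adj_of_mem_edges he) he
  rw [hx] at he
  obtain ⟨q, -, hqe, hqp⟩ := hp.exists_walk_of_mem_edges he
  have := q.iff_of_forall_edges (fun y => i.val + 1 ≤ cyclePos b y) fun u v huv hmem => by
    obtain ⟨⟨b', j⟩, hy⟩ := tree u v huv (hqp hmem)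
    have hne : b' = b → j.val ≠ i.val := by
      rintro rfl h
      obtain rfl : j = i := Fin.ext h
      exact hqe (hy ▸ hmem)
    have : i.val + 1 ≤ cyclePos b (some (b', j)) ↔ i.val + 1 ≤ cyclePos b (predVertex (b', j)) := by
      rw [cyclePos_predVertex, cyclePos]
      simp only
      split_ifs with hb
      · have := hne hb
        omega
      · rfl
    rcases Sym2.eq_iff.1 hy with ⟨rfl, rfl⟩ | ⟨rfl, rfl⟩
    · exact this
    · exact this.symm
  rw [cyclePos_predVertex] at this
  simp [cyclePos] at this

theorem natCast_zmod_three_eq {i : ℕ} (hg : g ≡ 4 [MOD 6]) (h : i + 1 = g - 1) :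
    (i : ZMod 3) = 2 := by
  have : i % 3 = 2 % 3 := by
    have h6 : g % 6 = 4 := hg
    omega
  exact (ZMod.natCast_eq_natCast_iff i 2 3).2 this

/-- The root's colour selects a cycle `b`. Starting from `0`, the lists `{i, i + 1}` modulo `3`
force colour `i + 1` at index `i`. As `g ≡ 1` modulo `3`, the last vertex is forced back to the
root's colour `0`. -/
theorem twoCycles_hasSeparatedBadLists (hg : g ≡ 4 [MOD 6]) :
    HasSeparatedBadLists (twoCycles g) 2 := by
  have h6 : g % 6 = 4 := hg
  let L : Option (Bool × Fin (g - 1)) → Finset (Bool × ZMod 3)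
    | none => {(false, 0), (true, 0)}
    | some (b, i) => {(b, (i.val : ZMod 3)), (b, (i.val : ZMod 3) + 1)}
  have hL : ∀ b i, L (some (b, i)) = {(b, (i.val : ZMod 3)), (b, (i.val : ZMod 3) + 1)} :=
    fun _ _ => rfl
  refine ⟨Bool × ZMod 3, inferInstance, inferInstance, L, ?_, ?_, ?_⟩
  · rintro (_ | ⟨b, i⟩)
    · simp only [L]; decide
    · rw [hL]
      exact (by decide : ∀ (b : Bool) (a : ZMod 3),
        ({(b, a), (b, a + 1)} : Finset (Bool × ZMod 3)).card = 2) _ _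
  · intro u v huv
    refine twoCycles_adj_rec (P := fun u v => (L u ∩ L v).card = 1)
      (fun u v h => by rwa [Finset.inter_comm]) ?_ (fun b i h => ?_) huv
    · rintro ⟨b, i⟩
      rw [predVertex]
      split_ifs with h
      · rw [hL]
        simp only at h
        simp only [L, h, Nat.cast_zero]
        revert b; decide
      · simp only at h
        obtain ⟨j, hj⟩ : ∃ j, i.val = j + 1 := ⟨i.val - 1, by omega⟩
        simp only [hL, hj, Nat.add_sub_cancel, Nat.cast_add, Nat.cast_one]
        exact (by decide : ∀ (b : Bool) (a : ZMod 3),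
          (({(b, a + 1), (b, a + 1 + 1)} : Finset (Bool × ZMod 3)) ∩ {(b, a), (b, a + 1)}).card
            = 1) _ _
    · rw [hL, natCast_zmod_three_eq hg h]
      simp only [L]
      revert b; decide
  · rintro ⟨f, hf, hfL⟩
    obtain ⟨b, hb⟩ : ∃ b, f none = (b, 0) := by
      have := hfL none
      simp only [L, Finset.mem_insert, Finset.mem_singleton] at this
      rcases this with h | h <;> exact ⟨_, h⟩
    have forced : ∀ (i : ℕ) (hi : i < g - 1), f (some (b, ⟨i, hi⟩)) = (b, (i : ZMod 3) + 1) := by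
      intro i
      induction i with
      | zero =>
        intro hi
        have h₁ := hfL (some (b, ⟨0, hi⟩))
        have h₂ := hf _ _ (twoCycles_adj_predVertex (b, ⟨0, hi⟩))
        rw [predVertex, if_pos rfl, hb] at h₂
        rw [hL, Finset.mem_insert, Finset.mem_singleton] at h₁
        simpa [h₂] using h₁
      | succ i ih =>
        intro hi
        have h₁ := hfL (some (b, ⟨i + 1, hi⟩))
        have h₂ := hf _ _ (twoCycles_adj_predVertex (b, ⟨i + 1, hi⟩))
        rw [predVertex, if_neg (by simp)] at h₂
        simp only [Nat.add_sub_cancel] at h₂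
        rw [ih (by omega)] at h₂
        rw [hL, Finset.mem_insert, Finset.mem_singleton] at h₁
        refine h₁.resolve_left fun h => h₂ ?_
        rw [h]; push_cast; rfl
    have h₁ := hf _ _ (twoCycles_adj_last b ⟨g - 2, by omega⟩ (by simp; omega))
    rw [forced, hb, natCast_zmod_three_eq hg (by omega)] at h₁
    exact h₁ (Prod.ext rfl (by decide : (2 : ZMod 3) + 1 = 0))

/-- Charge each edge to a predecessor to its non-root end, which leaves at most two closing edges.
If the root is present, this gives at most `(|V(H)| - 1) + 2`; if not, closing edges are absent. -/
theorem twoCycles_isNearlySparse (hg : 3 ≤ g) : IsNearlySparse (twoCycles g) 1 := by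
  intro H
  set T : Set (Bool × Fin (g - 1)) := {x | H.Adj (some x) (predVertex x)} with hT
  let last : Fin (g - 1) := ⟨g - 2, by omega⟩
  have hlast : ∀ i : Fin (g - 1), i.val + 1 = g - 1 → i = last := fun i hi =>
    Fin.ext (by simp only [last]; omega)
  set B : Set Bool := {b | H.Adj (some (b, last)) none} with hB
  have hE : H.edgeSet ⊆ (fun x => s(some x, predVertex x)) '' T ∪
      (fun b => s(some (b, last), none)) '' B := by
    intro e
    induction e using Sym2.ind with
    | _ u v =>
    intro he
    refine twoCycles_adj_rec (P := fun u v => H.Adj u v →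
      s(u, v) ∈ (fun x => s(some x, predVertex x)) '' T ∪ (fun b => s(some (b, last), none)) '' B)
      (fun u v h => ?_) (fun x h => .inl ⟨x, h, rfl⟩) (fun b i hi h => .inr ⟨b, ?_, ?_⟩)
      (H.adj_sub he) he
    · rw [Sym2.eq_swap]; exact fun h' => h h'.symm
    · rw [hlast i hi] at h; exact h
    · rw [hlast i hi]
  have hE' : H.edgeSet.ncard ≤ T.ncard + B.ncard :=
    (Set.ncard_le_ncard hE).trans ((Set.ncard_union_le _ _).trans
      (add_le_add (Set.ncard_image_le) (Set.ncard_image_le)))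
  have hB2 : B.ncard ≤ 2 := by
    simpa using Set.ncard_le_ncard (Set.subset_univ B)
  have hTV : (some '' T).ncard = T.ncard := Set.ncard_image_of_injective _ (Option.some_injective _)
  have hTV' : some '' T ⊆ H.verts := by
    rintro _ ⟨x, hx, rfl⟩
    exact H.edge_vert hx
  by_cases hroot : none ∈ H.verts
  · have hins : insert none (some '' T) ⊆ H.verts := Set.insert_subset hroot hTV'
    have hcard : (insert none (some '' T)).ncard = T.ncard + 1 := by
      rw [Set.ncard_insert_of_notMem (by simp), hTV]
    have hle := Set.ncard_le_ncard hins
    refine ⟨by omega, fun heq => ?_⟩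
    have hB' : B = Set.univ := Set.eq_of_subset_of_ncard_le (Set.subset_univ _) (by simp; omega)
    have hV : insert none (some '' T) = H.verts :=
      Set.eq_of_subset_of_ncard_le hins (by omega)
    have hmemT : ∀ x, some x ∈ H.verts → x ∈ T := fun x hx => by
      rw [← hV] at hx
      simpa using hx
    have hBall : ∀ b, H.Adj (some (b, last)) none := fun b => by
      have : b ∈ B := hB' ▸ Set.mem_univ b
      exact this
    -- In the case of equality every non-root vertex of `H` has its predecessor edge in `H`; go back
    -- along each cycle from its last vertex.
    have hall : ∀ (n : ℕ) (b : Bool) (i : Fin (g - 1)), i.val + 1 + n = g - 1 → (b, i) ∈ T := by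
      intro n
      induction n with
      | zero =>
        intro b i hi
        rw [hlast i hi]
        exact hmemT _ (H.edge_vert (hBall b))
      | succ n ih =>
        intro b i hi
        have h : H.Adj _ _ := ih b ⟨i.val + 1, by omega⟩ (by simp; omega)
        have h' := H.edge_vert h.symm
        rw [predVertex, if_neg (by simp)] at h'
        exact hmemT _ h'
    have hall' : ∀ x, x ∈ T := fun ⟨b, i⟩ => hall (g - 1 - (i.val + 1)) b i (by omega)
    apply SimpleGraph.Subgraph.ext
    · rw [SimpleGraph.Subgraph.verts_top, Set.eq_univ_iff_forall]
      rintro (_ | x)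
      · exact hroot
      · exact H.edge_vert (hall' x)
    · ext u v
      refine ⟨H.adj_sub, fun h => ?_⟩
      exact twoCycles_adj_rec (P := H.Adj) (fun u v h => h.symm) hall'
        (fun b i hi => by rw [hlast i hi]; exact hBall b) h
  · have hB0 : B = ∅ := Set.eq_empty_of_forall_notMem fun b hb =>
      hroot (H.edge_vert (SimpleGraph.Subgraph.Adj.symm hb))
    have hle := Set.ncard_le_ncard hTV'
    rw [hB0, Set.ncard_empty] at hE'
    omega

end TwoCycles

/-! ### Sparsity is inherited when copies are attached -/

section Sparse

theorem finite_reducedInner (d m : ℕ) : Finite (ReducedInner d m) :=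
  ((List.finite_length_lt (Fin d) m).subset fun _ h => h.1).to_subtype

theorem finite_reducedLeaf (d m : ℕ) : Finite (ReducedLeaf d m) :=
  ((List.finite_length_eq (Fin d) m).subset fun _ h => h.1).to_subtype

variable {n m : ℕ}

/-- The number of pairs of a vertex in `S` and a child of it in the reduced tree. -/
theorem card_children_le [DecidableEq (ReducedInner (n + 2) m)] (hm : 0 < m)
    (S : Finset (ReducedInner (n + 2) m)) :
    (S.sigma fun w => {i : Fin (n + 2) | (i :: w.1).IsChain (· ≠ ·)}).card ≤
      (n + 1) * S.card + if ⟨[], hm, List.isChain_nil⟩ ∈ S then 1 else 0 := by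
  rw [Finset.card_sigma]
  have : ∀ w ∈ S, Finset.card {i : Fin (n + 2) | (i :: w.1).IsChain (· ≠ ·)} ≤
      (n + 1) + if w = ⟨[], hm, List.isChain_nil⟩ then 1 else 0 := by
    rintro ⟨w, hw⟩ -
    cases w with
    | nil =>
      rw [if_pos rfl]
      exact (Finset.card_le_univ _).trans (by simp)
    | cons j w =>
      -- Below a non-root vertex one letter is forbidden, leaving `n + 1` children; only the root
      -- has `n + 2`.
      have hsub : ({i : Fin (n + 2) | (i :: j :: w).IsChain (· ≠ ·)} : Finset (Fin (n + 2))) ⊆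
          Finset.univ.erase j := fun i hi => by
        simp only [Finset.mem_filter, List.isChain_cons_cons] at hi
        simpa using hi.2.1
      refine (Finset.card_le_card hsub).trans ?_
      rw [Finset.card_erase_of_mem (Finset.mem_univ _), Finset.card_fin]
      omega
  refine (Finset.sum_le_sum this).trans ?_
  rw [Finset.sum_add_distrib, Finset.sum_const, smul_eq_mul, mul_comm, Finset.sum_ite_eq']

/-- If `E` and `F` are sets of inner vertices and leaves of the reduced tree whose parents lie in
`S`, then `|E| + |F|` is at most `(n + 1) |S| + 1`; in the case of equality, `S` contains the root
and `E` and `F` contain all children of the vertices in `S`. -/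
theorem card_lower_le (hm : 0 < m) (S E : Set (ReducedInner (n + 2) m))
    (F : Set (ReducedLeaf (n + 2) m))
    (hE : ∀ u ∈ E, ∃ w ∈ S, ∃ i, u.1 = i :: w.1) (hF : ∀ v ∈ F, ∃ w ∈ S, ∃ i, v.1 = i :: w.1) :
    E.ncard + F.ncard ≤ (n + 1) * S.ncard + 1 ∧
      (E.ncard + F.ncard = (n + 1) * S.ncard + 1 → ⟨[], hm, List.isChain_nil⟩ ∈ S ∧
        (∀ u : ReducedInner (n + 2) m, ∀ w ∈ S, ∀ i, u.1 = i :: w.1 → u ∈ E) ∧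
        ∀ v : ReducedLeaf (n + 2) m, ∀ w ∈ S, ∀ i, v.1 = i :: w.1 → v ∈ F) := by
  classical
  have := finite_reducedInner (n + 2) m
  have := finite_reducedLeaf (n + 2) m
  set A := S.toFinite.toFinset.sigma fun w => {i : Fin (n + 2) | (i :: w.1).IsChain (· ≠ ·)}
    with hA
  have hAcard := card_children_le hm S.toFinite.toFinset
  rw [← hA, ← Set.ncard_eq_toFinset_card S] at hAcard
  let word : E ⊕ F → List (Fin (n + 2)) := Sum.elim (fun u => u.1.1) (fun v => v.1.1)
  have hword : Function.Injective word := by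
    rintro (⟨u, hu⟩ | ⟨v, hv⟩) (⟨u', hu'⟩ | ⟨v', hv'⟩) h
    · exact congrArg Sum.inl (Subtype.ext (Subtype.ext h))
    · exact absurd (congrArg List.length h) (by
        have := u.2.1; have := v'.2.1; simp only [word, Sum.elim_inl, Sum.elim_inr]; omega)
    · exact absurd (congrArg List.length h) (by
        have := u'.2.1; have := v.2.1; simp only [word, Sum.elim_inl, Sum.elim_inr]; omega)
    · exact congrArg Sum.inr (Subtype.ext (Subtype.ext h))
  have hex : ∀ p : E ⊕ F, ∃ a ∈ A, word p = a.2 :: a.1.1 := by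
    rintro (⟨u, hu⟩ | ⟨v, hv⟩)
    · obtain ⟨w, hw, i, h⟩ := hE u hu
      exact ⟨⟨w, i⟩, by simpa [hA, hw] using h ▸ u.2.2, h⟩
    · obtain ⟨w, hw, i, h⟩ := hF v hv
      exact ⟨⟨w, i⟩, by simpa [hA, hw] using h ▸ v.2.2, h⟩
  choose φ hφA hφ using hex
  have hφi : Function.Injective φ := fun p q h => hword (by rw [hφ, hφ, h])
  have := Fintype.ofFinite (E ⊕ F)
  have hcard : (Finset.univ.image φ).card = E.ncard + F.ncard := by
    rw [Finset.card_image_of_injective _ hφi, Finset.card_univ, ← Nat.card_eq_fintype_card,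
      Nat.card_sum, Nat.card_coe_set_eq, Nat.card_coe_set_eq]
  have hsub : Finset.univ.image φ ⊆ A := by
    intro a ha
    obtain ⟨p, -, rfl⟩ := Finset.mem_image.1 ha
    exact hφA p
  have hle := Finset.card_le_card hsub
  refine ⟨by split_ifs at hAcard <;> omega, fun heq => ?_⟩
  have hroot : (⟨[], hm, List.isChain_nil⟩ : ReducedInner (n + 2) m) ∈ S := by
    by_contra hr
    rw [if_neg (by simpa using hr)] at hAcard
    omega
  have hall : ∀ w ∈ S, ∀ i, (i :: w.1).IsChain (· ≠ ·) → ∃ p, word p = i :: w.1 := by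
    intro w hw i hi
    have heqA : Finset.univ.image φ = A :=
      Finset.eq_of_subset_of_card_le hsub (by split_ifs at hAcard <;> omega)
    have hmem : (⟨w, i⟩ : (_ : ReducedInner (n + 2) m) × Fin (n + 2)) ∈ A := by
      simpa [hA, hw] using hi
    rw [← heqA] at hmem
    obtain ⟨p, -, hp⟩ := Finset.mem_image.1 hmem
    exact ⟨p, by rw [hφ, hp]⟩
  refine ⟨hroot, fun u w hw i h => ?_, fun v w hw i h => ?_⟩
  · obtain ⟨⟨u', hu'⟩ | ⟨v, hv⟩, hp⟩ := hall w hw i (h ▸ u.2.2)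
    · rwa [show u = u' from Subtype.ext (h.trans hp.symm)]
    · have := congrArg List.length (h.trans hp.symm)
      have := u.2.1
      have := v.2.1
      simp only [word, Sum.elim_inr] at *
      omega
  · obtain ⟨⟨u, hu⟩ | ⟨v', hv'⟩, hp⟩ := hall w hw i (h ▸ v.2.2)
    · have := congrArg List.length (h.trans hp.symm)
      have := v.2.1
      have := u.2.1
      simp only [word, Sum.elim_inl] at *
      omega
    · rwa [show v = v' from Subtype.ext (h.trans hp.symm)]

variable {V : Type} {G : SimpleGraph V} {ρ : V} {r : ℕ} {c : V → Bool}

/-- The embedding of `G` as the copy at the leaf `v`. -/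
def copyHom {d : ℕ} (G : SimpleGraph V) (ρ : V) (c : V → Bool) (β : ReducedLeaf d m → V → ℕ)
    (v : ReducedLeaf d m) : G →g attachCopies G ρ d m c β where
  toFun x := Sum.inr (v, x)
  map_rel' h := attachCopies_adj_copy v h

open Classical in
-- Here `U` stands for the copy vertices whose upward edge is in the subgraph. The surplus `1` needs
-- both equality in sparsity and all upward edges.
theorem IsNearlySparse.card_add_le (hG : IsNearlySparse G n) [Finite V] (H : G.Subgraph)
    {U : Set V} (hU : U ⊆ H.verts) :
    U.ncard + H.edgeSet.ncard ≤
      (n + 1) * H.verts.ncard + if H = ⊤ ∧ U = Set.univ then 1 else 0 := by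
  have h₁ := hG H
  have h₂ := Set.ncard_le_ncard hU
  have h₃ : (n + 1) * H.verts.ncard = n * H.verts.ncard + H.verts.ncard := by ring
  by_cases h : H = ⊤ ∧ U = Set.univ
  · rw [if_pos h]
    omega
  · rw [if_neg h]
    by_cases hH : H = ⊤
    · have : U ≠ H.verts := fun hU' => h ⟨hH, by rw [hU', hH]; rfl⟩
      have := Set.ncard_lt_ncard (hU.ssubset_of_ne this)
      omega
    · have : H.edgeSet.ncard ≠ _ := fun h' => hH (h₁.2 h')
      omega

theorem IsNearlySparse.attachCopies {D : List (Fin (n + 2)) → Finset ℕ}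
    {β : ReducedLeaf (n + 2) m → V → ℕ} [Finite V] (hG : IsNearlySparse G n) (hm : 0 < m)
    (hD : IsOddAugmentation (n + 2) r m D)
    (hβ : ∀ v, Set.BijOn (β v) {x | x ≠ ρ} (D v.1 : Set ℕ)) :
    IsNearlySparse (attachCopies G ρ (n + 2) m c β) (n + 1) := by
  classical
  have := finite_reducedInner (n + 2) m
  have := finite_reducedLeaf (n + 2) m
  have := Fintype.ofFinite (ReducedLeaf (n + 2) m)
  intro H
  let up : ReducedLeaf (n + 2) m → V → ReducedInner (n + 2) m := fun v x =>
    ⟨v.1.drop (upDist ρ c β v x), by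
      have := upDist_bounds (c := c) hm hD hβ v x
      rw [List.length_drop, v.2.1]; omega, v.2.2.drop _⟩
  have hup : ∀ v x (w : ReducedInner (n + 2) m), w.1 = v.1.drop (upDist ρ c β v x) → w = up v x :=
    fun v x w h => Subtype.ext h
  let tail : ReducedInner (n + 2) m → ReducedInner (n + 2) m := fun u =>
    ⟨u.1.tail, by have := u.2.1; rw [List.length_tail]; omega, u.2.2.tail⟩
  have htail : ∀ (u w : ReducedInner (n + 2) m) i, u.1 = i :: w.1 → w = tail u := fun u w i h =>
    Subtype.ext (by simp [tail, h])
  let S : Set (ReducedInner (n + 2) m) := {w | Sum.inl w ∈ H.verts}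
  let E : Set (ReducedInner (n + 2) m) :=
    {u | H.Adj (Sum.inl u) (Sum.inl (tail u)) ∧ ∃ i, u.1 = i :: (tail u).1}
  let C : ReducedLeaf (n + 2) m → G.Subgraph := fun v => H.comap (copyHom G ρ c β v)
  let U : ReducedLeaf (n + 2) m → Set V := fun v =>
    {x | H.Adj (Sum.inr (v, x)) (Sum.inl (up v x))}
  -- The copies that have a surplus. Each contains the edge from its leaf to the parent, so the leaf
  -- is charged as a child of a vertex of `S`.
  let F : Set (ReducedLeaf (n + 2) m) := {v | C v = ⊤ ∧ U v = Set.univ}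
  have hedge : H.edgeSet ⊆ (fun u => s(Sum.inl u, Sum.inl (tail u))) '' E ∪
      ⋃ v, ((fun x => s(Sum.inr (v, x), Sum.inl (up v x))) '' U v ∪
        Sym2.map (copyHom G ρ c β v) '' (C v).edgeSet) := by
    intro e
    induction e using Sym2.ind with
    | _ p q =>
    intro he
    refine attachCopies_adj_rec (P := fun p q => H.Adj p q → s(p, q) ∈
      (fun u => s(Sum.inl u, Sum.inl (tail u))) '' E ∪
      ⋃ v, ((fun x => s(Sum.inr (v, x), Sum.inl (up v x))) '' U v ∪
        Sym2.map (copyHom G ρ c β v) '' (C v).edgeSet))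
      (fun p q h => ?_) (fun u w i h hH => .inl ?_) (fun v x w h hH => .inr ?_)
      (fun v x y h hH => .inr ?_) (H.adj_sub he) he
    · rw [Sym2.eq_swap]; exact fun h' => h h'.symm
    · obtain rfl := htail u w i h
      exact ⟨u, ⟨hH, i, h⟩, rfl⟩
    · obtain rfl := hup v x w h
      exact Set.mem_iUnion.2 ⟨v, .inl ⟨x, hH, rfl⟩⟩
    · exact Set.mem_iUnion.2 ⟨v, .inr ⟨s(x, y), ⟨h, hH⟩, rfl⟩⟩
  have hedge' : H.edgeSet.ncard ≤ E.ncard + ∑ v, ((U v).ncard + (C v).edgeSet.ncard) := by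
    refine (Set.ncard_le_ncard hedge).trans ((Set.ncard_union_le _ _).trans
      (add_le_add Set.ncard_image_le ?_))
    refine (Set.ncard_iUnion_le_of_fintype _).trans (Finset.sum_le_sum fun v _ => ?_)
    exact (Set.ncard_union_le _ _).trans (add_le_add Set.ncard_image_le Set.ncard_image_le)
  have hverts : S.ncard + ∑ v, (C v).verts.ncard ≤ H.verts.ncard := by
    let ψ : S ⊕ (Σ v, (C v).verts) → H.verts :=
      Sum.elim (fun w => ⟨Sum.inl w.1, w.2⟩) (fun x => ⟨Sum.inr (x.1, x.2.1), x.2.2⟩)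
    have hψ : Function.Injective ψ := by
      rintro (⟨w, hw⟩ | ⟨v, x, hx⟩) (⟨w', hw'⟩ | ⟨v', x', hx'⟩) h
      · obtain rfl := Sum.inl.inj (congrArg Subtype.val h)
        rfl
      · exact absurd (congrArg Subtype.val h) Sum.inl_ne_inr
      · exact absurd (congrArg Subtype.val h) Sum.inr_ne_inl
      · obtain ⟨rfl, rfl⟩ := Prod.mk.inj (Sum.inr.inj (congrArg Subtype.val h))
        rfl
    have := Nat.card_le_card_of_injective ψ hψ
    simpa [Nat.card_sum, Nat.card_sigma, Nat.card_coe_set_eq] using this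
  have hcopy : ∀ v, (U v).ncard + (C v).edgeSet.ncard ≤
      (n + 1) * (C v).verts.ncard + if v ∈ F then 1 else 0 := by
    intro v
    refine (hG.card_add_le (C v) (U := U v) fun x hx => H.edge_vert hx).trans (le_of_eq ?_)
    congr
  have hFsum : ∑ v, (if v ∈ F then 1 else 0) = F.ncard := by
    rw [Finset.sum_boole, Set.ncard_eq_toFinset_card', Nat.cast_id]
    congr 1
    ext; simp
  have hsum : ∑ v, ((U v).ncard + (C v).edgeSet.ncard) ≤
      (n + 1) * ∑ v, (C v).verts.ncard + F.ncard := by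
    rw [← hFsum, Finset.mul_sum, ← Finset.sum_add_distrib]
    exact Finset.sum_le_sum fun v _ => hcopy v
  have hroot : ∀ v : ReducedLeaf (n + 2) m, ∃ i, v.1 = i :: (up v ρ).1 := by
    intro v
    obtain ⟨i, hi⟩ := drop_pred_eq_cons (v := v) le_rfl (Nat.succ_le_of_lt hm)
    exact ⟨i, by simpa [up, upDist_root] using hi⟩
  obtain ⟨hle, heq⟩ := card_lower_le hm S E F
    (fun u hu => ⟨tail u, H.edge_vert hu.1.symm, hu.2⟩) (fun v hv => by
      have hρ : ρ ∈ U v := by rw [hv.2]; trivial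
      obtain ⟨i, hi⟩ := hroot v
      exact ⟨up v ρ, H.edge_vert hρ.symm, i, hi⟩)
  have hmul := Nat.mul_le_mul_left (n + 1) hverts
  rw [mul_add] at hmul
  refine ⟨by omega, fun htop => ?_⟩
  obtain ⟨hr, hEall, hFall⟩ := heq (by omega)
  -- Equality puts the root and all children of vertices of `S` in play, so it spreads down level by
  -- level to the whole tree.
  have hS : ∀ (l : ℕ) (w : ReducedInner (n + 2) m), w.1.length = l → w ∈ S := by
    intro l
    induction l with
    | zero =>
      intro w hw
      rwa [show w = ⟨[], hm, List.isChain_nil⟩ from Subtype.ext (List.length_eq_zero_iff.1 hw)]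
    | succ l ih =>
      rintro ⟨w, hw⟩ hl
      cases w with
      | nil => simp at hl
      | cons i w =>
        exact H.edge_vert (hEall ⟨i :: w, hw⟩ (tail ⟨i :: w, hw⟩)
          (ih _ (by simpa [tail] using hl)) i rfl).1
  have hF : ∀ v, v ∈ F := fun v => by
    obtain ⟨i, hi⟩ := hroot v
    exact hFall v _ (hS _ _ rfl) i hi
  apply SimpleGraph.Subgraph.ext
  · rw [SimpleGraph.Subgraph.verts_top, Set.eq_univ_iff_forall]
    rintro (w | ⟨v, x⟩)
    · exact hS _ w rfl
    · have hx : x ∈ U v := by rw [(hF v).2]; trivial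
      exact H.edge_vert hx
  · ext p q
    refine ⟨H.adj_sub, fun h => ?_⟩
    refine attachCopies_adj_rec (P := H.Adj) (fun p q h => h.symm) (fun u w i h => ?_)
      (fun v x w h => ?_) (fun v x y h => ?_) h
    · obtain rfl := htail u w i h
      exact (hEall u _ (hS _ _ rfl) i h).1
    · obtain rfl := hup v x w h
      have hx : x ∈ U v := by rw [(hF v).2]; trivial
      exact hx
    · have hxy : (C v).Adj x y := by rw [(hF v).1]; exact h
      exact hxy.2

end Sparse

/-! ### The recursion and the main theorem -/

theorem IsChoiceGraph.properties {g k : ℕ} (hg : g ≡ 4 [MOD 6]) {V : Type} {G : SimpleGraph V}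
    {ρ : V} (h : IsChoiceGraph g k V G ρ) :
    2 ≤ k ∧ Finite V ∧ G.IsBipartite ∧ (g : ℕ∞) ≤ G.egirth ∧ IsNearlySparse G (k - 1) ∧
      HasSeparatedBadLists G k := by
  induction h with
  | base =>
    have h6 : g % 6 = 4 := hg
    exact ⟨le_rfl, inferInstance, twoCycles_isBipartite (Nat.even_iff.2 (by omega)),
      twoCycles_egirth, twoCycles_isNearlySparse (by omega), twoCycles_hasSeparatedBadLists hg⟩
  | @step k V G ρ _ m hm D hD c β hβ ih =>
    obtain ⟨hk, hfin, -, hgirth, hsparse, hlists⟩ := ih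
    have hD' := hD.isOddAugmentation
    have := finite_reducedInner (k + 1) m
    have := finite_reducedLeaf (k + 1) m
    refine ⟨by omega, inferInstance,
      attachCopies_isBipartite hm hD' hβ fun x y hxy => c.valid hxy,
      attachCopies_egirth hm hD' hβ hgirth hD.girth_le, ?_, hlists.attachCopies hm hD' hβ⟩
    obtain ⟨n, rfl⟩ : ∃ n, k = n + 1 := ⟨k - 1, by omega⟩
    exact hsparse.attachCopies hm hD' hβ

theorem exists_isChoiceGraph {g : ℕ} (hg : g ≡ 4 [MOD 6]) {k : ℕ} (hk : 2 ≤ k) :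
    ∃ (V : Type) (G : SimpleGraph V) (ρ : V), IsChoiceGraph g k V G ρ := by
  induction k, hk using Nat.le_induction with
  | base => exact ⟨_, _, _, .base⟩
  | succ k hk ih =>
    obtain ⟨V, G, ρ, h⟩ := ih
    obtain ⟨-, hfin, ⟨c⟩, -⟩ := h.properties hg
    obtain ⟨m, D, hm, hD⟩ := exists_isAugmentedTreeGraph (k + 1) (Nat.card V - 1) (2 * g)
      (Nat.succ_pos k)
    have hβ : ∀ v : ReducedLeaf (k + 1) m, ∃ β : V → ℕ,
        Set.BijOn β {x | x ≠ ρ} (D v.1 : Set ℕ) := fun v => by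
      -- Both sets have `|V| - 1` elements, so the distribution exists for every leaf.
      refine Set.Finite.exists_bijOn_of_encard_eq (Set.toFinite _) ?_
      rw [← Set.Finite.cast_ncard_eq (Set.toFinite _), Set.encard_coe_eq_coe_finsetCard,
        hD.card_eq _ v.2.1]
      have := Set.ncard_compl ({ρ} : Set V)
      rw [Set.ncard_singleton] at this
      exact congrArg _ this
    choose β hβ using hβ
    exact ⟨_, _, _, h.step m hm D hD
      (SimpleGraph.Coloring.mk (fun x => decide (c x = 0)) fun {x y} hxy => by
        have := c.valid hxy
        revert this
        generalize c x = a
        generalize c y = b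
        revert a b
        decide) β hβ⟩

theorem mainTheorem6 (g k : ℕ) (hg : g ≡ 4 [MOD 6]) (hk : 2 ≤ k) :
    (∃ (V : Type) (G : SimpleGraph V) (ρ : V), IsChoiceGraph g k V G ρ) ∧
    ∀ (V : Type) (G : SimpleGraph V) (ρ : V), IsChoiceGraph g k V G ρ →
      Finite V ∧ G.IsBipartite ∧ (g : ℕ∞) ≤ G.egirth ∧
      (∀ H : G.Subgraph, H ≠ ⊤ → avgDegree H ≤ 2 * ((k : ℚ) - 1)) ∧
      ∃ L : V → Finset ℕ,
        (∀ v, (L v).card = k) ∧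
        (∀ u v, G.Adj u v → (L u ∩ L v).card = 1) ∧
        ¬ IsListColorable G L := by
  refine ⟨exists_isChoiceGraph hg hk, fun V G ρ h => ?_⟩
  obtain ⟨-, h₁, h₂, h₃, h₄, h₅⟩ := h.properties hg
  refine ⟨h₁, h₂, h₃, fun H hH => ?_, h₅.exists_lists⟩
  have := h₄.avgDegree_le hH
  rwa [Nat.cast_sub (by omega), Nat.cast_one] at this
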